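/- **Theorem 2.** For a set $C$ of ordinals let $\operatorname{acc} C$ be the set of accumulation points of $C$ (nonzero ordinals $\alpha$ such that for every $\beta<\alpha$ there is $\gamma\in C$ with $\beta<\gamma<\alpha$), and let $\operatorname{nacc} C=C\setminus\operatorname{acc} C$. Let $\mu$ be an infinite cardinal and suppose that (a) $\lambda=\mu^+=2^\mu$ and $\mu=\mu^{<\mu}$; (b) $S^*\subseteq\{\alpha<\lambda:\operatorname{cf}\alpha=\mu\}$ and $\langle c_\delta:\delta\in S^*\rangle$ is a sequence such that each $c_\delta\subseteq\delta$ is a set of limit ordinals that is closed in $\delta$ and satisfies $\delta=\sup c_\delta$; (c) for every $\delta\in S^*$ and $\alpha\in\operatorname{nacc}c_\delta$, $P_{\delta,\alpha}\subseteq\mathcal P(\alpha)$ and $|P_{\delta,\alpha}|\le\operatorname{cf}\alpha$, and if $\alpha\in S^*$ then $|P_{\delta,\alpha}|<\mu$; (d) for every set $A\subseteq\lambda$ and every club $E\subseteq\lambda$ there is a stationary set $S_{A,E}\subseteq S^*$ such that for every $\delta\in S_{A,E}$, $\delta=\sup\{\alpha\in\operatorname{nacc}c_\delta: A\cap\alpha\in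 P_{\delta,\alpha}\text{ and }\alpha\in E\}$; (e) if $\delta,\delta^*\in S^*$ and $\delta\in\operatorname{acc}c_{\delta^*}$, then there is some $\alpha<\delta$ such that for every $\beta\in\operatorname{nacc}c_\delta$ with $\beta>\alpha$ we have $\beta\in\operatorname{nacc}c_{\delta^*}$ and $P_{\delta,\beta}=P_{\delta^*,\beta}$; (f) for every $\gamma<\lambda$, $\left|\{\langle P_{\delta,\alpha}:\alpha\in\operatorname{nacc}c_\delta\cap\gamma\rangle:\delta\in S^*\}\right|\le\mu$. Then there is a $\mu$-complete Souslin tree on $\lambda$: a tree order on the set $\lambda$ (a strict partial order in which the predecessors of each element are well ordered) of height $\lambda$, in which every chain and every antichain has cardinality less than $\lambda$, and in which every increasing sequence of length less than $\mu$ has an upper bound. -/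

import Mathlib

open Set

universe u v

/-- `Below κ` is the initial ordinal of the cardinal `κ`, i.e. the set of all ordinals smaller than
`κ.ord`, with its usual order. -/
abbrev Below (κ : Cardinal.{u}) : Type (u + 1) := Set.Iio κ.ord

/-- The accumulation points of `C`: the nonzero ordinals `α` with `α = sup (C ∩ α)`,
the supremum not being attained. -/
def acc {κ : Cardinal.{u}} (C : Set (Below κ)) : Set (Below κ) :=
  {α | α.1 ≠ 0 ∧ ∀ β < α, ∃ γ ∈ C, β < γ ∧ γ < α}

/-- The non-accumulation points of `C` that belong to `C`. -/
def nacc {κ : Cardinal.{u}} (C : Set (Below κ)) : Set (Below κ) :=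
  C \ acc C

/-- For `c = ⟨c_δ⟩` and `P = ⟨P_{δ,α}⟩`, the sequence `⟨P_{δ,α} : α ∈ nacc c_δ ∩ γ⟩`, that is, the
function with domain `nacc c_δ ∩ γ` sending `α` to `P_{δ,α}`, represented by its graph. -/
def guessSeq {κ : Cardinal.{u}} (c : Below κ → Set (Below κ))
    (P : Below κ → Below κ → Set (Set (Below κ))) (γ δ : Below κ) :
    Set (Below κ × Set (Set (Below κ))) :=
  {p | p.1 ∈ nacc (c δ) ∧ p.1 < γ ∧ p.2 = P δ p.1}

/-- `r` is a (strict) tree order on `T`: a strict partial order in which the predecessors of every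
element are well ordered. -/
structure IsTreeOrder {T : Type v} (r : T → T → Prop) : Prop where
  irrefl : ∀ x, ¬ r x x
  trans : ∀ x y z, r x y → r y z → r x z
  wellOrder_pred : ∀ x, IsWellOrder {y // r y x} (fun a b => r a b)

/-- `x` lies on level `β` of the tree: the set of its predecessors has order type `β`. -/
def HasLevel {T : Type v} (r : T → T → Prop) (x : T) (β : Ordinal.{u}) : Prop :=
  Nonempty ((fun a b : {y // r y x} => r a b) ≃r (fun a b : Set.Iio β => a < b))

/-- `r` makes `T` a `κ`-Souslin tree: a tree of height `κ` in which all chains and all antichains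
have cardinality smaller than `κ`. -/
structure IsSouslinTree (κ : Cardinal.{u}) {T : Type v} (r : T → T → Prop) : Prop where
  tree : IsTreeOrder r
  level_lt : ∀ x, ∃ β < κ.ord, HasLevel r x β
  level_nonempty : ∀ β < κ.ord, ∃ x, HasLevel r x β
  chain_lt : ∀ C : Set T, IsChain r C →
    Cardinal.lift.{u} (Cardinal.mk C) < Cardinal.lift.{v} κ
  antichain_lt : ∀ A : Set T, IsAntichain r A →
    Cardinal.lift.{u} (Cardinal.mk A) < Cardinal.lift.{v} κ

/-- The tree is `μ`-complete: every increasing sequence of length smaller than `μ` has an upper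
bound. -/
def IsCompleteTree (μ : Cardinal.{u}) {T : Type v} (r : T → T → Prop) : Prop :=
  ∀ o < μ.ord, ∀ s : Set.Iio o → T, (∀ i j, i < j → r (s i) (s j)) →
    ∃ x, ∀ i, s i = x ∨ r (s i) x

open Cardinal

/-! ### Cofinality, counting and recursion in well-orders -/

section WellOrder

variable {K : Type v} [LinearOrder K]

/-! Write `K` for λ and `m` for μ. A node on level α is a subset of `Iio α`, the order is
end-extension, and the levels are defined by recursion. Where the cofinality of α is not `m`, every
cofinal branch receives a node; μ^{<μ} = μ keeps such levels small, and chains of fewer than μ nodes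
get upper bounds. Where the cofinality is `m`, only canonical branches are kept. A climb starts at a
node and follows, along `nacc (c δ)`, the fixed choice `next` of an extension that meets every
predense set listed in `P δ α`; its limits are kept at limits of `nacc (c δ)`. Off `S`, one chosen
branch is also kept for each starting node and each family to be met. A climb is determined by its
starting node and the graph of `P δ` below α, so `hsmall` leaves at most μ of them (`mk_level_le`).

On a level δ in `S` every node is a limit of a climb. The climb may run along another δ', but by
`hcoh` it eventually obeys the families of δ. Enlarge an antichain to a maximal one and code it as A
⊆ λ, using 2^μ = λ; on a club E the part of A below α is predense below α. By `hguess` some δ in `S`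
has cofinally many α ∈ E with A ∩ α listed in `P δ α`. Each node on level δ has therefore met A
below δ (`exists_hits`), so the antichain lives below level δ (`mk_antichain_le`). An unbounded
chain would give a cofinal branch, and the nodes splitting off it would form an antichain of size λ.

It remains that no node dies out and that the required hits exist (`extends_and_hitsAt`). The
delicate case is α in `S` and in `nacc (c δ)`, where only climbs survive: fewer than μ sets are
listed there, so all are met strictly below α before climbing. -/

theorem cof_Iio_le_mk {ι : Type v} {f : ι → K} {ρ : K} (hf : ∀ i, f i < ρ)
    (h : ∀ t < ρ, ∃ i, t ≤ f i) : Order.cof (Iio ρ) ≤ #ι := by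
  refine (Order.cof_le (s := range fun i => (⟨f i, hf i⟩ : Iio ρ)) ?_).trans mk_range_le
  rintro ⟨t, ht⟩
  obtain ⟨i, hi⟩ := h t ht
  exact ⟨_, ⟨i, rfl⟩, hi⟩

theorem exists_lt_of_mk_lt_cof {ι : Type v} {f : ι → K} {ρ : K} (hf : ∀ i, f i < ρ)
    (h : #ι < Order.cof (Iio ρ)) : ∃ t < ρ, ∀ i, f i < t := by
  by_contra! H
  exact (cof_Iio_le_mk hf H).not_gt h

/-- Counts objects by data that determine them. A relation is used because one object may have many
descriptions and some data may describe nothing. -/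
theorem mk_le_of_forall_exists_unique {X Y : Type v} {s : Set X} {q : Set Y} (R : Y → X → Prop)
    (hex : ∀ x ∈ s, ∃ y ∈ q, R y x) (huniq : ∀ y, ∀ x ∈ s, ∀ x' ∈ s, R y x → R y x' → x = x') :
    #s ≤ #q := by
  choose f hf hR using hex
  refine mk_le_of_injective (f := fun x : s => (⟨f x x.2, hf x x.2⟩ : q)) ?_
  rintro ⟨x, hx⟩ ⟨x', hx'⟩ h
  have h' : f x hx = f x' hx' := congrArg Subtype.val h
  exact Subtype.ext (huniq _ x hx x' hx' (hR x hx) (h' ▸ hR x' hx'))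

/-- `α` is a limit of elements of `C` below `α`. -/
def IsLimitOf (C : Set K) (α : K) : Prop :=
  (Iio α).Nonempty ∧ ∀ β < α, ∃ γ ∈ C, β < γ ∧ γ < α

variable [WellFoundedLT K]

theorem exists_isLUB_of_bddAbove {s : Set K} (hs : BddAbove s) : ∃ ρ, IsLUB s ρ :=
  let ⟨ρ, hρ, hmin⟩ := WellFounded.has_min (wellFounded_lt (α := K)) (upperBounds s) hs
  ⟨ρ, hρ, fun _ hb => not_lt.1 (hmin _ hb)⟩

/-- Choice along a well-order: `hQ` says that the requirement at `i` reads only the earlier values,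
so the junk value used from `i` on is harmless. -/
theorem exists_forall_of_forall_lt_exists {X : Type*} [Nonempty X] (Q : K → (K → X) → X → Prop)
    (hQ : ∀ i f g n, (∀ j < i, f j = g j) → Q i f n → Q i g n)
    (h : ∀ i f, (∀ j < i, Q j f (f j)) → ∃ n, Q i f n) :
    ∃ f : K → X, ∀ i, Q i f (f i) := by
  classical
  let F : ∀ i, (∀ j, j < i → X) → X := fun i f =>
    Classical.epsilon (Q i fun j => if hj : j < i then f j hj else Classical.arbitrary X)
  let f := (wellFounded_lt (α := K)).fix F
  refine ⟨f, fun i => ?_⟩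
  induction i using WellFoundedLT.induction with
  | ind i ih =>
    have hf : f i = Classical.epsilon
        (Q i fun j => if j < i then f j else Classical.arbitrary X) :=
      (wellFounded_lt (α := K)).fix_eq F i
    obtain ⟨n, hn⟩ := h i f ih
    have := Classical.epsilon_spec (p := Q i fun j => if j < i then f j else Classical.arbitrary X)
      ⟨n, hQ i f _ n (fun j hj => by simp [hj]) hn⟩
    rw [← hf] at this
    exact hQ i _ f _ (fun j hj => by simp [hj]) this

end WellOrder

/-! ### Recursive definition of the levels -/

/-- The data for the construction of a tree: cofinal sets `N δ ⊆ δ` for `δ ∈ S`, a small guessing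
family `P δ α` for every `α ∈ N δ`, and an injective coding of the bounded subsets. -/
structure GuessingSystem (K : Type v) [LinearOrder K] where
  m : Cardinal.{v}
  S : Set K
  N : K → Set K
  P : K → K → Set (Set K)
  code : K × Set K → K

namespace GuessingSystem

variable {K : Type v} [LinearOrder K] (D : GuessingSystem K)

/-- The graph of `⟨P δ α : α ∈ N δ ∩ γ⟩`. -/
def graph (γ δ : K) : Set (K × Set (Set K)) :=
  {p | p.1 ∈ D.N δ ∧ p.1 < γ ∧ p.2 = D.P δ p.1}

/-- Some initial segment of the branch `s` below `α` has its code in `A`. -/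
def Hits (α : K) (s A : Set K) : Prop :=
  ∃ β < α, D.code (β, s ∩ Iio β) ∈ A

/-- Every node of the tree `L` below `α` has an extension below `α` that lies above a node with
code in `A`. -/
def Predense (L : K → Set (Set K)) (α : K) (A : Set K) : Prop :=
  ∀ β < α, ∀ z ∈ L β, ∃ γ < α, β ≤ γ ∧ ∃ z' ∈ L γ, z' ∩ Iio β = z ∧
    ∃ β' ≤ γ, D.code (β', z' ∩ Iio β') ∈ A

def HitsAll (L : K → Set (Set K)) (α : K) (𝒜 : Set (Set K)) (s : Set K) : Prop :=
  ∀ A ∈ 𝒜, D.Predense L α A → D.Hits α s A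

/-- The chosen extension to level `α` of the node `z` on level `ρ`. -/
noncomputable def next (L : K → Set (Set K)) (α ρ : K) (z : Set K) (𝒜 : Set (Set K)) : Set K :=
  Classical.epsilon fun y => y ∈ L α ∧ y ∩ Iio ρ = z ∧ D.HitsAll L α 𝒜 y

/-- Above level `η`, the branch `s` follows the chosen extensions along the sequence `g`. -/
def IsClimb (L : K → Set (Set K)) (g : Set (K × Set (Set K))) (η : K) (s : Set K) : Prop :=
  ∀ α ℬ, (α, ℬ) ∈ g → η < α → ∀ ρ, IsLUB (insert η {γ | γ < α ∧ ∃ ℬ', (γ, ℬ') ∈ g}) ρ →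
    s ∩ Iio α = D.next L α ρ (s ∩ Iio ρ) ℬ

/-- `s` is a cofinal branch of the tree `L` below `α`. -/
def IsBranch (L : K → Set (Set K)) (α : K) (s : Set K) : Prop :=
  s ⊆ Iio α ∧ ∀ β < α, s ∩ Iio β ∈ L β

/-- A chosen cofinal branch below `α` that extends `x` and hits all elements of `𝒜`. -/
noncomputable def directHit (L : K → Set (Set K)) (α η : K) (x : Set K) (𝒜 : Set (Set K)) :
    Set K :=
  Classical.epsilon fun s => IsBranch L α s ∧ s ∩ Iio η = x ∧ D.HitsAll L α 𝒜 s

/-- The index δ need not be α, since climbs are also interrupted at limits below δ. Only the graph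
truncated at α enters, which keeps these branches few. -/
def IsClimbLimit (L : K → Set (Set K)) (α : K) (s : Set K) : Prop :=
  ∃ η < α, s ∩ Iio η ∈ L η ∧ ∃ δ ∈ D.S, IsLimitOf (D.N δ) α ∧ D.IsClimb L (D.graph α δ) η s

/-- The empty family supplies plain extensions where nothing has to be met. -/
def IsDirectHit (L : K → Set (Set K)) (α : K) (s : Set K) : Prop :=
  ∃ η < α, ∃ x ∈ L η, ∃ 𝒜, (𝒜 = ∅ ∨ ∃ δ ∈ D.S, α ∈ D.N δ ∧ 𝒜 = D.P δ α) ∧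
    s = D.directHit L α η x 𝒜

/-- Level `α` of the tree, computed from the levels below `α`. -/
def step (L : K → Set (Set K)) (α : K) : Set (Set K) :=
  {s | IsBranch L α s ∧ (Order.cof (Iio α) = D.m →
    D.IsClimbLimit L α s ∨ α ∉ D.S ∧ D.IsDirectHit L α s)}

variable {D} {L L' : K → Set (Set K)} {α : K}

theorem isBranch_congr (h : ∀ β < α, L β = L' β) (s : Set K) :
    IsBranch L α s ↔ IsBranch L' α s :=
  and_congr_right fun _ => forall₂_congr fun β hβ => by rw [h β hβ]

theorem predense_congr (h : ∀ β < α, L β = L' β) (A : Set K) :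
    D.Predense L α A ↔ D.Predense L' α A := by
  refine forall₂_congr fun β hβ => ?_
  rw [h β hβ]
  refine forall₂_congr fun z _ => exists_congr fun γ => and_congr_right fun hγ => ?_
  rw [h γ hγ]

theorem hitsAll_congr (h : ∀ β < α, L β = L' β) (𝒜 : Set (Set K)) (s : Set K) :
    D.HitsAll L α 𝒜 s ↔ D.HitsAll L' α 𝒜 s :=
  forall₂_congr fun A _ => by rw [predense_congr h]

theorem next_congr (h : ∀ β < α, L β = L' β) {γ : K} (hγ : γ < α) :
    D.next L γ = D.next L' γ := by
  funext ρ z 𝒜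
  unfold next
  congr 1
  funext y
  rw [h γ hγ, hitsAll_congr fun β hβ => h β (hβ.trans hγ)]

theorem directHit_congr (h : ∀ β < α, L β = L' β) : D.directHit L α = D.directHit L' α := by
  funext η x 𝒜
  unfold directHit
  congr 1
  funext s
  rw [isBranch_congr h, hitsAll_congr h]

/-- Truncating the graph at α makes `next` consult only levels below α, as the recursion requires.
-/
theorem isClimb_congr (h : ∀ β < α, L β = L' β) (δ η : K) (s : Set K) :
    D.IsClimb L (D.graph α δ) η s ↔ D.IsClimb L' (D.graph α δ) η s := by
  refine forall₂_congr fun γ ℬ => forall_congr' fun hγ => ?_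
  rw [next_congr h hγ.2.1]

theorem step_congr (h : ∀ β < α, L β = L' β) : D.step L α = D.step L' α := by
  ext s
  refine and_congr (isBranch_congr h s) (imp_congr_right fun _ => or_congr ?_ ?_)
  · refine exists_congr fun η => and_congr_right fun hη => ?_
    rw [h η hη]
    simp only [isClimb_congr h]
  · refine and_congr_right fun _ => exists_congr fun η => and_congr_right fun hη => ?_
    rw [h η hη, directHit_congr h]

theorem inter_inter_Iio {s : Set K} {β γ : K} (h : β ≤ γ) : s ∩ Iio γ ∩ Iio β = s ∩ Iio β := by
  rw [inter_assoc, inter_eq_right.2 (Iio_subset_Iio h)]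

theorem iUnion_inter_Iio {ι : Type*} {ℓ : ι → K} {w : ι → Set K}
    (h : ∀ i j, ℓ i ≤ ℓ j → w j ∩ Iio (ℓ i) = w i) (i : ι) :
    (⋃ j, w j) ∩ Iio (ℓ i) = w i := by
  ext t
  simp only [mem_inter_iff, mem_iUnion]
  constructor
  · rintro ⟨⟨j, hj⟩, ht⟩
    rcases le_total (ℓ i) (ℓ j) with hij | hij
    · exact h i j hij ▸ ⟨hj, ht⟩
    · have := h j i hij ▸ hj
      exact this.1
  · intro ht
    have := h i i le_rfl ▸ ht
    exact ⟨⟨i, ht⟩, this.2⟩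

variable [WellFoundedLT K]

variable (D) in
open Classical in
/-- The levels of the tree. -/
noncomputable def level : K → Set (Set K) :=
  (wellFounded_lt (α := K)).fix fun α L => D.step (fun β => if h : β < α then L β h else ∅) α

theorem level_eq (α : K) : D.level α = D.step D.level α := by
  conv_lhs => rw [level, WellFounded.fix_eq]
  exact step_congr fun β hβ => by simp [hβ, level]

theorem isBranch_of_mem_level {s : Set K} (hs : s ∈ D.level α) : IsBranch D.level α s := by
  rw [level_eq] at hs
  exact hs.1

theorem subset_Iio_of_mem_level {s : Set K} (hs : s ∈ D.level α) : s ⊆ Iio α :=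
  (isBranch_of_mem_level hs).1

theorem inter_Iio_of_mem_level {s : Set K} (hs : s ∈ D.level α) : s ∩ Iio α = s :=
  inter_eq_left.2 (subset_Iio_of_mem_level hs)

theorem inter_mem_level {s : Set K} (hs : s ∈ D.level α) {β : K} (hβ : β ≤ α) :
    s ∩ Iio β ∈ D.level β := by
  rcases hβ.lt_or_eq with h | rfl
  · exact (isBranch_of_mem_level hs).2 β h
  · rwa [inter_Iio_of_mem_level hs]

theorem IsBranch.mem_level {s : Set K} (hs : IsBranch D.level α s)
    (hα : Order.cof (Iio α) ≠ D.m) : s ∈ D.level α := by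
  rw [level_eq]
  exact ⟨hs, fun h => (hα h).elim⟩

section Union

variable {ι : Type v} {ℓ : ι → K} {w : ι → Set K}

theorem isBranch_iUnion (hw : ∀ i, w i ∈ D.level (ℓ i))
    (h : ∀ i j, ℓ i ≤ ℓ j → w j ∩ Iio (ℓ i) = w i) {ρ : K} (hρ : IsLUB (range ℓ) ρ) :
    IsBranch D.level ρ (⋃ j, w j) := by
  refine ⟨iUnion_subset fun i => (subset_Iio_of_mem_level (hw i)).trans
    (Iio_subset_Iio (hρ.1 ⟨i, rfl⟩)), fun β hβ => ?_⟩
  obtain ⟨_, ⟨i, rfl⟩, hi, -⟩ := hρ.exists_between hβ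
  rw [← inter_inter_Iio hi.le, iUnion_inter_Iio h]
  exact inter_mem_level (hw i) hi.le

/-- Either the supremum is attained and the union is one of the nodes, or its cofinality is below
`m`, where no branch is discarded. This is the source of completeness. -/
theorem iUnion_mem_level (hw : ∀ i, w i ∈ D.level (ℓ i))
    (h : ∀ i j, ℓ i ≤ ℓ j → w j ∩ Iio (ℓ i) = w i) {ρ : K} (hρ : IsLUB (range ℓ) ρ)
    (hι : #ι < D.m) : (⋃ j, w j) ∈ D.level ρ := by
  have hb := isBranch_iUnion hw h hρ
  by_cases H : ∃ i, ℓ i = ρ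
  · obtain ⟨i, rfl⟩ := H
    rw [← inter_eq_left.2 hb.1, iUnion_inter_Iio h]
    exact hw i
  · push Not at H
    refine hb.mem_level (((cof_Iio_le_mk (f := ℓ) (fun i => (hρ.1 ⟨i, rfl⟩).lt_of_ne (H i))
      fun t ht => ?_).trans_lt hι).ne)
    obtain ⟨_, ⟨i, rfl⟩, hi, -⟩ := hρ.exists_between ht
    exact ⟨i, hi.le⟩

end Union

/-- Each step is dictated by the part below the supremum of the earlier points, so induction along
the graph recovers the climb from its start. -/
theorem IsClimb.unique {g : Set (K × Set (Set K))} {η : K} {s s' : Set K}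
    (hs : D.IsClimb L g η s) (hs' : D.IsClimb L g η s') (hη : s ∩ Iio η = s' ∩ Iio η)
    (hsα : s ⊆ Iio α) (hsα' : s' ⊆ Iio α)
    (hg : ∀ β < α, ∃ γ ℬ, (γ, ℬ) ∈ g ∧ β < γ ∧ γ < α) : s = s' := by
  have key : ∀ γ ℬ, (γ, ℬ) ∈ g → s ∩ Iio γ = s' ∩ Iio γ := by
    intro γ
    induction γ using WellFoundedLT.induction with
    | ind γ ih =>
      intro ℬ hγ
      rcases le_or_gt γ η with hγη | hγη
      · rw [← inter_inter_Iio hγη, hη, inter_inter_Iio hγη]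
      · obtain ⟨ρ, hρ⟩ : ∃ ρ, IsLUB (insert η {β | β < γ ∧ ∃ ℬ', (β, ℬ') ∈ g}) ρ := by
          refine exists_isLUB_of_bddAbove ⟨γ, ?_⟩
          rintro β (rfl | hβ)
          · exact hγη.le
          · exact hβ.1.le
        rw [hs γ ℬ hγ hγη ρ hρ, hs' γ ℬ hγ hγη ρ hρ]
        congr 1
        -- Any `t` below `ρ` lies below an earlier point of the climb, where the two branches
        -- already agree.
        ext t
        refine and_congr_left fun ht => ?_
        obtain ⟨β, hβ, htβ, -⟩ := hρ.exists_between ht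
        have : s ∩ Iio β = s' ∩ Iio β := by
          rcases hβ with rfl | ⟨hβγ, ℬ', hβg⟩
          · exact hη
          · exact ih β hβγ ℬ' hβg
        have := congrArg (t ∈ ·) this
        simpa [mem_Iio.1 htβ] using this
  ext t
  by_cases ht : t < α
  · obtain ⟨γ, ℬ, hγ, htγ, -⟩ := hg t ht
    have := congrArg (t ∈ ·) (key γ ℬ hγ)
    simpa [htγ] using this
  · exact iff_of_false (fun h => ht (hsα h)) fun h => ht (hsα' h)

end GuessingSystem

/-! ### Branches through prescribed predense sets -/

namespace GuessingSystem

variable {K : Type v} [LinearOrder K] {D : GuessingSystem K} {α : K}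

theorem coherent_of_lt {ι : Type*} [LinearOrder ι] {ℓ : ι → K} {w : ι → Set K}
    (hw : ∀ i, w i ⊆ Iio (ℓ i))
    (h : ∀ i j, i < j → ℓ i ≤ ℓ j ∧ w j ∩ Iio (ℓ i) = w i) (i j : ι) (hij : ℓ i ≤ ℓ j) :
    w j ∩ Iio (ℓ i) = w i := by
  rcases lt_trichotomy i j with H | rfl | H
  · exact (h i j H).2
  · exact inter_eq_left.2 (hw i)
  · obtain ⟨h1, h2⟩ := h j i H
    rw [← h2, inter_inter_Iio hij]
    exact inter_eq_left.2 (hw i)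

/-- The hypotheses on a guessing system that are used in the construction of the tree. -/
structure Good (D : GuessingSystem K) : Prop where
  aleph0_le : ℵ₀ ≤ D.m
  mk_Iio_le : ∀ α : K, #(Iio α) ≤ D.m
  power_le : ∀ c < D.m, D.m ^ c ≤ D.m
  cof_eq : ∀ δ ∈ D.S, Order.cof (Iio δ) = D.m
  lt_of_mem : ∀ δ ∈ D.S, ∀ α ∈ D.N δ, α < δ
  isLimitOf : ∀ δ ∈ D.S, IsLimitOf (D.N δ) δ
  not_isLimitOf : ∀ δ ∈ D.S, ∀ α ∈ D.N δ, ¬ IsLimitOf (D.N δ) α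
  aleph0_le_cof : ∀ δ ∈ D.S, ∀ α ∈ D.N δ, ℵ₀ ≤ Order.cof (Iio α)
  mk_le : ∀ δ ∈ D.S, ∀ α ∈ D.N δ, #(D.P δ α) ≤ Order.cof (Iio α)
  mk_lt : ∀ δ ∈ D.S, ∀ α ∈ D.N δ, α ∈ D.S → #(D.P δ α) < D.m
  mk_graph_le : ∀ γ : K, #(D.graph γ '' D.S) ≤ D.m
  coherent : ∀ δ ∈ D.S, ∀ δ' ∈ D.S, IsLimitOf (D.N δ') δ →
    ∃ α < δ, ∀ β ∈ D.N δ, α < β → β ∈ D.N δ' ∧ D.P δ β = D.P δ' β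
  exists_bound : ∀ s : Set K, #s ≤ D.m → ∃ b, ∀ t ∈ s, t < b
  code_injOn : InjOn D.code {p | p.2 ⊆ Iio p.1}
  guess : ∀ A E : Set K, IsClub E →
    ∃ δ ∈ D.S, ∀ β < δ, ∃ α ∈ D.N δ, β < α ∧ A ∩ Iio α ∈ D.P δ α ∧ α ∈ E

theorem Good.cof_Iio_le (hD : D.Good) (α : K) : Order.cof (Iio α) ≤ D.m :=
  (Order.cof_le_cardinalMk _).trans (hD.mk_Iio_le α)

/-- A point of `N δ` is not a limit of `N δ`, so a climb always has room below its next point. -/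
theorem Good.lt_of_isLUB (hD : D.Good) {δ η ρ : K} (hδ : δ ∈ D.S) (hα : α ∈ D.N δ) (hη : η < α)
    (hρ : IsLUB (insert η {β | β < α ∧ β ∈ D.N δ}) ρ) : ρ < α := by
  refine (hρ.2 ?_).lt_of_ne ?_
  · rintro τ (rfl | hτ)
    · exact hη.le
    · exact hτ.1.le
  · rintro rfl
    refine hD.not_isLimitOf δ hδ ρ hα ⟨⟨η, hη⟩, fun β hβ => ?_⟩
    obtain ⟨τ, rfl | hτ, hτβ, -⟩ := hρ.exists_between (max_lt hβ hη)
    · exact (lt_irrefl _ ((le_max_right _ _).trans_lt hτβ)).elim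
    · exact ⟨τ, hτ.2, (le_max_left _ _).trans_lt hτβ, hτ.1⟩

variable [WellFoundedLT K]

variable (D) in
/-- Every node on a level `β ≤ γ` has an extension on level `γ`. -/
def Extends (γ : K) : Prop :=
  ∀ β ≤ γ, ∀ x ∈ D.level β, ∃ y ∈ D.level γ, y ∩ Iio β = x

namespace Good

/-- A common extension of a short chain of nodes. -/
theorem exists_upper_bound (hD : D.Good) {ι : Type v} [LinearOrder ι] {f : ι → K × Set K}
    {η : K} (hη : η < α) {x : Set K} (hx : x ∈ D.level η) (hι : #ι < Order.cof (Iio α))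
    (hf : ∀ j, (f j).1 < α) (hmem : ∀ j, (f j).2 ∈ D.level (f j).1) (hηf : ∀ j, η ≤ (f j).1)
    (hxf : ∀ j, (f j).2 ∩ Iio η = x)
    (hcoh : ∀ i j, i < j → (f i).1 ≤ (f j).1 ∧ (f j).2 ∩ Iio (f i).1 = (f i).2) :
    ∃ ρ < α, η ≤ ρ ∧ ∃ V ∈ D.level ρ, V ∩ Iio η = x ∧
      ∀ j, (f j).1 ≤ ρ ∧ V ∩ Iio (f j).1 = (f j).2 := by
  rcases isEmpty_or_nonempty ι with he | ⟨⟨j₀⟩⟩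
  · exact ⟨η, hη, le_rfl, x, hx, inter_Iio_of_mem_level hx, fun j => (he.false j).elim⟩
  · obtain ⟨t, ht, htf⟩ := exists_lt_of_mk_lt_cof hf hι
    obtain ⟨ρ, hρ⟩ := exists_isLUB_of_bddAbove (s := range fun j => (f j).1)
      ⟨t, by rintro _ ⟨j, rfl⟩; exact (htf j).le⟩
    have hle : ∀ j, (f j).1 ≤ ρ := fun j => hρ.1 ⟨j, rfl⟩
    have hcoh' := coherent_of_lt (fun i => subset_Iio_of_mem_level (hmem i)) hcoh
    have hV : ∀ j, (⋃ j, (f j).2) ∩ Iio (f j).1 = (f j).2 := iUnion_inter_Iio hcoh'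
    refine ⟨ρ, (hρ.2 (by rintro _ ⟨j, rfl⟩; exact (htf j).le)).trans_lt ht,
      (hηf j₀).trans (hle j₀), _,
      iUnion_mem_level hmem hcoh' hρ (hι.trans_le (hD.cof_Iio_le α)), ?_,
      fun j => ⟨hle j, hV j⟩⟩
    rw [← inter_inter_Iio (hηf j₀), hV, hxf]

/-- A recursion of length the cofinality of α: each stage passes one point of a cofinal set and
meets one predense set. Limit stages survive because fewer than `m` nodes have been chosen. The
branch obtained need not belong to level α. -/
theorem exists_branch (hD : D.Good) (hα : ℵ₀ ≤ Order.cof (Iio α)) (hext : ∀ γ < α, D.Extends γ)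
    {η : K} (hη : η < α) {x : Set K} (hx : x ∈ D.level η) {𝒜 : Set (Set K)}
    (h𝒜 : #𝒜 ≤ Order.cof (Iio α)) :
    ∃ s, IsBranch D.level α s ∧ s ∩ Iio η = x ∧ D.HitsAll D.level α 𝒜 s := by
  obtain ⟨C, hC, hCcard⟩ := Order.exists_cof_eq (α := Iio α)
  let ι := (Order.cof (Iio α)).ord.ToType
  have hι : #ι = Order.cof (Iio α) := by simp [ι]
  have hIio : ∀ i : ι, #(Iio i) < Order.cof (Iio α) := fun i =>
    (mk_Iio_lt i (by simp [ι])).trans_eq hι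
  -- By injectivity of `k` and `a`, each stage is responsible for at most one point of `C` and one
  -- member of `𝒜`.
  obtain ⟨⟨k, hk⟩⟩ : Nonempty (C ↪ ι) := by rw [← Cardinal.le_def, hι, hCcard]
  obtain ⟨⟨a, ha⟩⟩ : Nonempty (𝒜 ↪ ι) := by rwa [← Cardinal.le_def, hι]
  let Q : ι → (ι → K × Set K) → K × Set K → Prop := fun i f n =>
    n.1 < α ∧ n.2 ∈ D.level n.1 ∧ η ≤ n.1 ∧ n.2 ∩ Iio η = x ∧
    (∀ j < i, (f j).1 ≤ n.1 ∧ n.2 ∩ Iio (f j).1 = (f j).2) ∧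
    (∀ c : C, k c = i → c.1.1 ≤ n.1) ∧
    (∀ A : 𝒜, a A = i → D.Predense D.level α A.1 → ∃ β ≤ n.1, D.code (β, n.2 ∩ Iio β) ∈ A.1)
  obtain ⟨f, hf⟩ : ∃ f : ι → K × Set K, ∀ i, Q i f (f i) := by
    have : Nonempty (K × Set K) := ⟨(η, x)⟩
    refine exists_forall_of_forall_lt_exists Q ?_ ?_
    · rintro i f g n hfg ⟨h1, h2, h3, h4, h5, h6, h7⟩
      exact ⟨h1, h2, h3, h4, fun j hj => hfg j hj ▸ h5 j hj, h6, h7⟩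
    · intro i f hf
      obtain ⟨ρ, hρα, hηρ, V, hV, hVx, hVf⟩ := hD.exists_upper_bound (ι := Iio i)
        (f := fun j => f j) hη hx (hIio i) (fun j => (hf j j.2).1) (fun j => (hf j j.2).2.1)
        (fun j => (hf j j.2).2.2.1) (fun j => (hf j j.2).2.2.2.1)
        (fun j₁ j₂ h => (hf j₂ j₂.2).2.2.2.2.1 j₁ h)
      obtain ⟨σ, hσα, hρσ, W, hW, hWV, hWC⟩ : ∃ σ < α, ρ ≤ σ ∧ ∃ W ∈ D.level σ,
          W ∩ Iio ρ = V ∧ ∀ c : C, k c = i → c.1.1 ≤ σ := by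
        by_cases h : ∃ c : C, k c = i ∧ ρ < c.1.1
        · obtain ⟨c, hc, hρc⟩ := h
          obtain ⟨W, hW, hWV⟩ := hext c.1.1 c.1.2 ρ hρc.le V hV
          exact ⟨c.1.1, c.1.2, hρc.le, W, hW, hWV, fun c' hc' => by rw [hk (hc'.trans hc.symm)]⟩
        · push Not at h
          exact ⟨ρ, hρα, le_rfl, V, hV, inter_Iio_of_mem_level hV, h⟩
      obtain ⟨τ, hτα, hστ, Y, hY, hYW, hYA⟩ : ∃ τ < α, σ ≤ τ ∧ ∃ Y ∈ D.level τ,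
          Y ∩ Iio σ = W ∧ ∀ A : 𝒜, a A = i → D.Predense D.level α A.1 →
            ∃ β ≤ τ, D.code (β, Y ∩ Iio β) ∈ A.1 := by
        by_cases h : ∃ A : 𝒜, a A = i ∧ D.Predense D.level α A.1
        · obtain ⟨A, hA, hpre⟩ := h
          obtain ⟨τ, hτ, hστ, Y, hY, hYW, hβ⟩ := hpre σ hσα W hW
          exact ⟨τ, hτ, hστ, Y, hY, hYW, fun A' hA' _ => by rwa [ha (hA'.trans hA.symm)]⟩
        · push Not at h
          exact ⟨σ, hσα, le_rfl, W, hW, inter_Iio_of_mem_level hW, fun A hA hA' =>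
            (h A hA hA').elim⟩
      have hYV : Y ∩ Iio ρ = V := by rw [← inter_inter_Iio hρσ, hYW, hWV]
      refine ⟨(τ, Y), hτα, hY, (hηρ.trans hρσ).trans hστ, ?_, fun j hj => ⟨?_, ?_⟩,
        fun c hc => (hWC c hc).trans hστ, hYA⟩
      · rw [← inter_inter_Iio hηρ, hYV, hVx]
      · exact ((hVf ⟨j, hj⟩).1.trans hρσ).trans hστ
      · rw [← inter_inter_Iio (hVf ⟨j, hj⟩).1, hYV]
        exact (hVf ⟨j, hj⟩).2
  have hcoh := coherent_of_lt (fun i => subset_Iio_of_mem_level (hf i).2.1)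
    fun i j hij => (hf j).2.2.2.2.1 i hij
  have hmem : ∀ i, (f i).2 ∈ D.level (f i).1 := fun i => (hf i).2.1
  have hV : ∀ j, (⋃ j, (f j).2) ∩ Iio (f j).1 = (f j).2 := iUnion_inter_Iio hcoh
  have hcof : ∀ t < α, ∃ i, t ≤ (f i).1 := fun t ht => by
    obtain ⟨c, hc, htc⟩ := hC ⟨t, ht⟩
    exact ⟨k ⟨c, hc⟩, le_trans htc ((hf _).2.2.2.2.2.1 ⟨c, hc⟩ rfl)⟩
  have hlub : IsLUB (range fun i => (f i).1) α := by
    refine ⟨by rintro _ ⟨i, rfl⟩; exact (hf i).1.le, fun b hb => ?_⟩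
    by_contra! hlt
    obtain ⟨i, hi⟩ := hcof b hlt
    -- An upper bound `b < α` of the levels would be the maximum of `Iio α`, contradicting infinite
    -- cofinality.
    refine (cof_Iio_le_mk (ι := PUnit) (f := fun _ => b) (fun _ => hlt) fun t ht => ?_).not_gt
      (lt_of_lt_of_le ?_ hα)
    · obtain ⟨i, hi⟩ := hcof t ht
      exact ⟨⟨⟩, hi.trans (hb ⟨i, rfl⟩)⟩
    · simp
  obtain ⟨i₀, -⟩ := hcof η hη
  refine ⟨⋃ j, (f j).2, isBranch_iUnion hmem hcoh hlub, ?_, fun A hA hpre => ?_⟩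
  · rw [← inter_inter_Iio (hf i₀).2.2.1, hV, (hf i₀).2.2.2.1]
  · obtain ⟨β, hβ, hβA⟩ := (hf (a ⟨A, hA⟩)).2.2.2.2.2.2 ⟨A, hA⟩ rfl hpre
    refine ⟨β, hβ.trans_lt (hf _).1, ?_⟩
    rwa [← inter_inter_Iio hβ, hV]

end Good
end GuessingSystem

/-! ### Climbs, and extension of nodes to all higher levels -/

namespace GuessingSystem

variable {K : Type v} [LinearOrder K] {D : GuessingSystem K} {α : K}

theorem mem_graph {γ δ : K} {ℬ : Set (Set K)} :
    (α, ℬ) ∈ D.graph γ δ ↔ α ∈ D.N δ ∧ α < γ ∧ ℬ = D.P δ α :=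
  Iff.rfl

theorem setOf_exists_mem_graph {δ ρ : K} (hα : α ≤ ρ) :
    {β | β < α ∧ ∃ ℬ, (β, ℬ) ∈ D.graph ρ δ} = {β | β < α ∧ β ∈ D.N δ} := by
  ext β
  refine and_congr_right fun hβ => ⟨fun ⟨_, h⟩ => h.1, fun h =>
    ⟨D.P δ β, mem_graph.2 ⟨h, hβ.trans_le hα, rfl⟩⟩⟩

variable [WellFoundedLT K]

variable (D) in
/-- Every node below level `γ` can be extended to level `γ` so as to hit all predense sets of each
relevant guessing family. -/
def HitsAt (γ : K) : Prop :=
  ∀ δ ∈ D.S, γ ∈ D.N δ → ∀ η < γ, ∀ x ∈ D.level η, ∃ y ∈ D.level γ, y ∩ Iio η = x ∧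
    D.HitsAll D.level γ (D.P δ γ) y

theorem HitsAt.next_spec {γ : K} (h : D.HitsAt γ) {δ : K} (hδ : δ ∈ D.S) (hγ : γ ∈ D.N δ)
    {η : K} (hη : η < γ) {x : Set K} (hx : x ∈ D.level η) :
    D.next D.level γ η x (D.P δ γ) ∈ D.level γ ∧ D.next D.level γ η x (D.P δ γ) ∩ Iio η = x ∧
      D.HitsAll D.level γ (D.P δ γ) (D.next D.level γ η x (D.P δ γ)) :=
  Classical.epsilon_spec (p := fun y => y ∈ D.level γ ∧ y ∩ Iio η = x ∧
    D.HitsAll D.level γ (D.P δ γ) y) (h δ hδ hγ η hη x hx)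

variable (D) in
/-- The node `s` on level `γ` continues the climb `f` along `N δ` that starts with the node `x` on
level `η`. -/
def ClimbStep (δ η : K) (x : Set K) (γ : K) (f : K → Set K) (s : Set K) : Prop :=
  γ ∈ D.N δ → η < γ → s ∈ D.level γ ∧ s ∩ Iio η = x ∧
    (∀ γ' < γ, γ' ∈ D.N δ → η < γ' → s ∩ Iio γ' = f γ') ∧
    ∀ ρ, IsLUB (insert η {β | β < γ ∧ β ∈ D.N δ}) ρ →
      s = D.next D.level γ ρ (s ∩ Iio ρ) (D.P δ γ)

/-- If the supremum is a point of the climb, the node there serves. Otherwise it is a limit of `N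
δ`, and the union is a climb limit, admitted even at cofinality `m`. The case `ρ = γ = δ` completes
a climb. -/
theorem ClimbStep.exists_union {δ η γ ρ : K} {x : Set K} {f : K → Set K} (hδ : δ ∈ D.S)
    (hx : x ∈ D.level η) (hρ : IsLUB (insert η {β | β < γ ∧ β ∈ D.N δ}) ρ) (hργ : ρ ≤ γ)
    (hf : ∀ γ' < γ, D.ClimbStep δ η x γ' f (f γ')) :
    ∃ V ∈ D.level ρ, V ∩ Iio η = x ∧ ∀ γ' ∈ D.N δ, η < γ' → γ' < γ → V ∩ Iio γ' = f γ' := by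
  by_cases H : ∃ γ' ∈ D.N δ, η < γ' ∧ γ' < γ
  · obtain ⟨γ₀, hγ₀, hηγ₀, hγ₀γ⟩ := H
    let ι := {γ' // γ' ∈ D.N δ ∧ η < γ' ∧ γ' < γ}
    have hfi : ∀ i : ι, _ := fun i => hf i.1 i.2.2.2 i.2.1 i.2.2.1
    have hlub : IsLUB (range fun i : ι => i.1) ρ := by
      refine ⟨by rintro _ ⟨i, rfl⟩; exact hρ.1 (Or.inr ⟨i.2.2.2, i.2.1⟩), fun b hb => hρ.2 ?_⟩
      have hηb : η ≤ b := hηγ₀.le.trans (hb ⟨⟨γ₀, hγ₀, hηγ₀, hγ₀γ⟩, rfl⟩)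
      rintro β (rfl | ⟨hβ, hβN⟩)
      · exact hηb
      · rcases le_or_gt β η with h | h
        · exact h.trans hηb
        · exact hb ⟨⟨β, hβN, h, hβ⟩, rfl⟩
    have hmem : ∀ i : ι, f i.1 ∈ D.level i.1 := fun i => (hfi i).1
    have hcoh := coherent_of_lt (ℓ := fun i : ι => i.1) (w := fun i : ι => f i.1)
      (fun i => subset_Iio_of_mem_level (hmem i))
      fun i j hij => ⟨le_of_lt hij, (hfi j).2.2.1 i.1 hij i.2.1 i.2.2.1⟩
    have hV : ∀ i : ι, (⋃ i : ι, f i.1) ∩ Iio i.1 = f i.1 := iUnion_inter_Iio hcoh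
    have hV' : ∀ γ' ∈ D.N δ, η < γ' → γ' < γ → (⋃ i : ι, f i.1) ∩ Iio γ' = f γ' :=
      fun γ' h1 h2 h3 => hV ⟨γ', h1, h2, h3⟩
    have hb := isBranch_iUnion hmem hcoh hlub
    have hVη : (⋃ i : ι, f i.1) ∩ Iio η = x := by
      rw [← inter_inter_Iio hηγ₀.le, hV' γ₀ hγ₀ hηγ₀ hγ₀γ, (hf γ₀ hγ₀γ hγ₀ hηγ₀).2.1]
    refine ⟨_, ?_, hVη, hV'⟩
    by_cases hatt : ρ ∈ D.N δ ∧ ρ < γ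
    · have hηρ : η < ρ := hηγ₀.trans_le (hρ.1 (Or.inr ⟨hγ₀γ, hγ₀⟩))
      rw [← inter_eq_left.2 hb.1, hV' ρ hatt.1 hηρ hatt.2]
      exact hmem ⟨ρ, hatt.1, hηρ, hatt.2⟩
    · have hηρ : η < ρ := hηγ₀.trans_le (hρ.1 (Or.inr ⟨hγ₀γ, hγ₀⟩))
      rw [level_eq]
      refine ⟨hb, fun _ => Or.inl ⟨η, hηρ, hVη ▸ hx, δ, hδ, ⟨⟨η, hηρ⟩, fun β hβ => ?_⟩, ?_⟩⟩
      · obtain ⟨_, ⟨i, rfl⟩, hi, hiρ⟩ := hlub.exists_between hβ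
        refine ⟨i.1, i.2.1, hi, hiρ.lt_of_ne ?_⟩
        rintro h
        exact hatt ⟨h ▸ i.2.1, h ▸ i.2.2.2⟩
      · intro β ℬ hβg hηβ σ hσ
        obtain ⟨hβN, hβρ, rfl⟩ := mem_graph.1 hβg
        rw [setOf_exists_mem_graph hβρ.le] at hσ
        have hβγ := hβρ.trans_le hργ
        have hσβ : σ ≤ β := hσ.2 (by
          rintro τ (rfl | hτ)
          · exact hηβ.le
          · exact hτ.1.le)
        have h1 := (hf β hβγ hβN hηβ).2.2.2 σ hσ
        rw [← inter_inter_Iio (s := ⋃ i : ι, f i.1) hσβ, hV' β hβN hηβ hβγ]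
        exact h1
  · push Not at H
    have : ρ = η := le_antisymm (hρ.2 (by
      rintro τ (rfl | hτ)
      · exact le_rfl
      · exact not_lt.1 fun h => (H τ hτ.2 h).not_gt hτ.1)) (hρ.1 (Or.inl rfl))
    subst this
    exact ⟨x, hx, inter_Iio_of_mem_level hx, fun γ' h1 h2 h3 => ((H γ' h1 h2).not_gt h3).elim⟩

namespace Good

/-- Climbing along `N δ` gives an extension on level `δ`. -/
theorem exists_climb (hD : D.Good) {δ : K} (hδ : δ ∈ D.S) (hhit : ∀ γ < δ, D.HitsAt γ) {η : K}
    (hη : η < δ) {x : Set K} (hx : x ∈ D.level η) : ∃ y ∈ D.level δ, y ∩ Iio η = x := by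
  obtain ⟨f, hf⟩ : ∃ f : K → Set K, ∀ γ, D.ClimbStep δ η x γ f (f γ) := by
    refine exists_forall_of_forall_lt_exists (D.ClimbStep δ η x) ?_ ?_
    · intro γ f g s hfg h hγ hηγ
      obtain ⟨h1, h2, h3, h4⟩ := h hγ hηγ
      exact ⟨h1, h2, fun γ' hγ' => hfg γ' hγ' ▸ h3 γ' hγ', h4⟩
    · intro γ f hf
      by_cases hγ : γ ∈ D.N δ ∧ η < γ
      · obtain ⟨hγN, hηγ⟩ := hγ
        have hub : γ ∈ upperBounds (insert η {β | β < γ ∧ β ∈ D.N δ}) := by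
          rintro τ (rfl | hτ)
          · exact hηγ.le
          · exact hτ.1.le
        obtain ⟨ρ, hρ⟩ := exists_isLUB_of_bddAbove ⟨γ, hub⟩
        have hργ : ρ < γ := hD.lt_of_isLUB hδ hγN hηγ hρ
        have hηρ : η ≤ ρ := hρ.1 (Or.inl rfl)
        obtain ⟨V, hV, hVx, hVf⟩ := ClimbStep.exists_union hδ hx hρ hργ.le hf
        obtain ⟨h1, h2, -⟩ := (hhit γ (hD.lt_of_mem δ hδ γ hγN)).next_spec hδ hγN hργ hV
        refine ⟨_, fun _ _ => ⟨h1, ?_, fun γ' hγ' hγ'N hηγ' => ?_, fun σ hσ => ?_⟩⟩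
        · rw [← inter_inter_Iio hηρ, h2, hVx]
        · rw [← inter_inter_Iio (hρ.1 (Or.inr ⟨hγ', hγ'N⟩)), h2, hVf γ' hγ'N hηγ' hγ']
        · rw [hσ.unique hρ, h2]
      · exact ⟨∅, fun h1 h2 => (hγ ⟨h1, h2⟩).elim⟩
  have hlub : IsLUB (insert η {β | β < δ ∧ β ∈ D.N δ}) δ := by
    refine ⟨?_, fun b hb => ?_⟩
    · rintro τ (rfl | hτ)
      · exact hη.le
      · exact hτ.1.le
    · by_contra! hlt
      obtain ⟨γ, hγ, hbγ, hγδ⟩ := (hD.isLimitOf δ hδ).2 b hlt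
      exact (hb (Or.inr ⟨hγδ, hγ⟩)).not_gt hbγ
  obtain ⟨V, hV, hVx, -⟩ := ClimbStep.exists_union hδ hx hlub le_rfl fun γ _ => hf γ
  exact ⟨V, hV, hVx⟩

/-- If fewer than `m` sets have to be hit, this can be done below `α`. -/
theorem exists_hitsAll_of_mk_lt (hD : D.Good) (hα : Order.cof (Iio α) = D.m)
    (hext : ∀ γ < α, D.Extends γ) {η : K} (hη : η < α) {x : Set K} (hx : x ∈ D.level η)
    {𝒜 : Set (Set K)} (h𝒜 : #𝒜 < D.m) :
    ∃ ρ < α, η ≤ ρ ∧ ∃ z ∈ D.level ρ, z ∩ Iio η = x ∧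
      ∀ y, y ∩ Iio ρ = z → D.HitsAll D.level α 𝒜 y := by
  -- The branch `s` may have no node on level α; only a proper initial segment of it, long enough to
  -- contain all the hits, is kept.
  obtain ⟨s, hs, hsx, hA⟩ := hD.exists_branch (hD.aleph0_le.trans_eq hα.symm) hext hη hx
    (h𝒜.le.trans_eq hα.symm)
  have : ∀ A : 𝒜, ∃ β < α, D.Predense D.level α A.1 → D.code (β, s ∩ Iio β) ∈ A.1 := by
    intro A
    by_cases h : D.Predense D.level α A.1
    · obtain ⟨β, hβ, hβA⟩ := hA A.1 A.2 h
      exact ⟨β, hβ, fun _ => hβA⟩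
    · exact ⟨η, hη, fun h' => (h h').elim⟩
  choose β hβα hβ using this
  obtain ⟨t, ht, hβt⟩ := exists_lt_of_mk_lt_cof hβα (h𝒜.trans_eq hα.symm)
  have hρ : max t η < α := max_lt ht hη
  refine ⟨max t η, hρ, le_max_right _ _, _, hs.2 _ hρ, ?_, fun y hy A hAA hpre => ?_⟩
  · rw [inter_inter_Iio (le_max_right _ _), hsx]
  · have hle : β ⟨A, hAA⟩ ≤ max t η := (hβt _).le.trans (le_max_left _ _)
    refine ⟨β ⟨A, hAA⟩, hβα _, ?_⟩
    rw [← inter_inter_Iio hle, hy, inter_inter_Iio hle]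
    exact hβ ⟨A, hAA⟩ hpre

/-- The two claims need a joint induction: climbing to a level in `S` uses hits below it, and
producing hits uses extensions below. -/
theorem extends_and_hitsAt (hD : D.Good) (α : K) : D.Extends α ∧ D.HitsAt α := by
  induction α using WellFoundedLT.induction with
  | ind α ih =>
    have hext : ∀ γ < α, D.Extends γ := fun γ hγ => (ih γ hγ).1
    have hhit : ∀ γ < α, D.HitsAt γ := fun γ hγ => (ih γ hγ).2
    have key : (∀ η < α, ∀ x ∈ D.level η, ∃ y ∈ D.level α, y ∩ Iio η = x) →
        D.Extends α := by
      intro h β hβ x hx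
      rcases hβ.lt_or_eq with hβ | rfl
      · exact h β hβ x hx
      · exact ⟨x, hx, inter_Iio_of_mem_level hx⟩
    by_cases hS : α ∈ D.S
    · have hE : D.Extends α := key fun η hη x hx => hD.exists_climb hS hhit hη hx
      refine ⟨hE, fun δ hδ hα η hη x hx => ?_⟩
      -- No direct hit is admitted on a level in `S`: the fewer than `m` sets are met below α first,
      -- and any extension to α inherits the hits.
      obtain ⟨ρ, hρ, hηρ, z, hz, hzx, hzA⟩ := hD.exists_hitsAll_of_mk_lt (hD.cof_eq α hS) hext hη hx
        (hD.mk_lt δ hδ α hα hS)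
      obtain ⟨y, hy, hyz⟩ := hE ρ hρ.le z hz
      exact ⟨y, hy, by rw [← inter_inter_Iio hηρ, hyz, hzx], hzA y hyz⟩
    by_cases hα : ℵ₀ ≤ Order.cof (Iio α)
    · have hit : ∀ 𝒜, (𝒜 = ∅ ∨ ∃ δ ∈ D.S, α ∈ D.N δ ∧ 𝒜 = D.P δ α) → ∀ η < α,
          ∀ x ∈ D.level η, ∃ y ∈ D.level α, y ∩ Iio η = x ∧ D.HitsAll D.level α 𝒜 y := by
        intro 𝒜 h𝒜 η hη x hx
        have hex := hD.exists_branch hα hext hη hx (𝒜 := 𝒜) (by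
          rcases h𝒜 with rfl | ⟨δ, hδ, hαδ, rfl⟩
          · simp
          · exact hD.mk_le δ hδ α hαδ)
        obtain ⟨h1, h2, h3⟩ := Classical.epsilon_spec hex
        refine ⟨D.directHit D.level α η x 𝒜, ?_, h2, h3⟩
        rw [level_eq]
        exact ⟨h1, fun _ => Or.inr ⟨hS, η, hη, x, hx, 𝒜, h𝒜, rfl⟩⟩
      refine ⟨key fun η hη x hx => ?_, fun δ hδ hα η hη x hx => hit _
        (Or.inr ⟨δ, hδ, hα, rfl⟩) η hη x hx⟩
      obtain ⟨y, hy, hyx, -⟩ := hit ∅ (Or.inl rfl) η hη x hx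
      exact ⟨y, hy, hyx⟩
    · refine ⟨key fun η hη x hx => ?_, fun δ hδ hα' => (hα (hD.aleph0_le_cof δ hδ α hα')).elim⟩
      have h1 : Order.cof (Iio α) = 1 := by
        refine le_antisymm (Order.cof_lt_aleph0_iff.1 (not_le.1 hα)) ?_
        have : Nonempty (Iio α) := ⟨⟨η, hη⟩⟩
        exact Cardinal.one_le_iff_ne_zero.2 Order.cof_ne_zero
      obtain ⟨⟨γ, hγ⟩, htop⟩ := Order.cof_eq_one_iff.1 h1
      have hle : ∀ β < α, β ≤ γ := fun β hβ => htop ⟨β, hβ⟩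
      obtain ⟨y, hy, hyx⟩ := hext γ hγ η (hle η hη) x hx
      refine ⟨y, IsBranch.mem_level ⟨(subset_Iio_of_mem_level hy).trans
        (Iio_subset_Iio (le_of_lt hγ)), fun β hβ => inter_mem_level hy (hle β hβ)⟩ ?_, hyx⟩
      rw [h1]
      exact (one_lt_aleph0.trans_le hD.aleph0_le).ne

end Good
end GuessingSystem

/-- The closure points of a function form a club. -/
theorem isClub_setOf_forall_lt {K : Type v} [LinearOrder K] [WellFoundedLT K]
    {m : Cardinal.{v}} (hm : ℵ₀ ≤ m) (hIio : ∀ α : K, #(Iio α) ≤ m)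
    (hb : ∀ s : Set K, #s ≤ m → ∃ b, ∀ t ∈ s, t < b) (G : K → K) :
    IsClub {α : K | ∀ β < α, G β < α} := by
  refine ⟨fun d hd hne _ a ha β hβ => ?_, fun a => ?_⟩
  · obtain ⟨t, ht, hβt, hta⟩ := ha.exists_between hβ
    exact (hd ht β hβt).trans_le hta
  · have : ∀ x : K, ∃ y, ∀ β < x, G β < y := fun x => by
      obtain ⟨y, hy⟩ := hb (G '' Iio x) (mk_image_le.trans (hIio x))
      exact ⟨y, fun β hβ => hy _ ⟨β, hβ, rfl⟩⟩
    choose H hH using this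
    let f : ℕ → K := fun n => H^[n] a
    obtain ⟨b, hfb⟩ := hb (range f)
      (hm.trans' (by simpa using mk_range_le_lift (f := f)))
    obtain ⟨ρ, hρ⟩ := exists_isLUB_of_bddAbove (s := range f) ⟨b, fun t ht => (hfb t ht).le⟩
    refine ⟨ρ, fun β hβ => ?_, hρ.1 ⟨0, rfl⟩⟩
    obtain ⟨_, ⟨n, rfl⟩, hn, -⟩ := hρ.exists_between hβ
    exact (hH _ β hn).trans_le (hρ.1 ⟨n + 1, Function.iterate_succ_apply' H n a⟩)

/-! ### Levels have at most `m` nodes -/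

namespace GuessingSystem

variable {K : Type v} [LinearOrder K] {D : GuessingSystem K} {α : K} [WellFoundedLT K]

theorem mk_biUnion_level_le (hm : ℵ₀ ≤ D.m) (hα : #(Iio α) ≤ D.m)
    (h : ∀ β < α, #(D.level β) ≤ D.m) : #(⋃ β ∈ Iio α, D.level β : Set (Set K)) ≤ D.m := by
  refine (mk_biUnion_le _ _).trans ((mul_le_mul' hα ?_).trans_eq (mul_eq_self hm))
  exact ciSup_le' fun β => h β.1 β.2

theorem mk_setOf_lt_le (hm : ℵ₀ ≤ D.m) (hα : #(Iio α) ≤ D.m)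
    (h : ∀ β < α, #(D.level β) ≤ D.m) :
    #{p : K × Set K | p.1 < α ∧ p.2 ∈ D.level p.1} ≤ D.m := by
  refine (mk_le_mk_of_subset
    (t := Iio α ×ˢ (⋃ β ∈ Iio α, D.level β : Set (Set K))) fun p hp => ?_).trans ?_
  · exact ⟨hp.1, mem_biUnion hp.1 hp.2⟩
  · rw [mk_setProd]
    exact (mul_le_mul' hα (mk_biUnion_level_le hm hα h)).trans_eq (mul_eq_self hm)

namespace Good

theorem mk_setOf_isClimbLimit_le (hD : D.Good) (h : ∀ β < α, #(D.level β) ≤ D.m) :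
    #{s | s ⊆ Iio α ∧ D.IsClimbLimit D.level α s} ≤ D.m := by
  refine (mk_le_of_forall_exists_unique
    (q := {p : K × Set K | p.1 < α ∧ p.2 ∈ D.level p.1} ×ˢ (D.graph α '' {δ | δ ∈ D.S ∧ IsLimitOf (D.N δ) α}))
    (fun y s => s ∩ Iio y.1.1 = y.1.2 ∧ D.IsClimb D.level y.2 y.1.1 s ∧
      ∀ β < α, ∃ γ ℬ, (γ, ℬ) ∈ y.2 ∧ β < γ ∧ γ < α) ?_ ?_).trans ?_
  · rintro s ⟨hs, η, hη, hx, δ, hδ, hlim, hclimb⟩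
    refine ⟨((η, s ∩ Iio η), D.graph α δ), ⟨⟨hη, hx⟩, δ, ⟨hδ, hlim⟩, rfl⟩, rfl, hclimb,
      fun β hβ => ?_⟩
    obtain ⟨γ, hγ, hβγ, hγα⟩ := hlim.2 β hβ
    exact ⟨γ, D.P δ γ, mem_graph.2 ⟨hγ, hγα, rfl⟩, hβγ, hγα⟩
  · rintro ⟨⟨η, x⟩, g⟩ s hs s' hs' ⟨h1, h2, h3⟩ ⟨h1', h2', -⟩
    exact h2.unique h2' (h1.trans h1'.symm) hs.1 hs'.1 h3
  · rw [mk_setProd]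
    refine (mul_le_mul' (mk_setOf_lt_le hD.aleph0_le (hD.mk_Iio_le α) h) ?_).trans_eq
      (mul_eq_self hD.aleph0_le)
    exact (mk_le_mk_of_subset (image_mono fun δ hδ => hδ.1)).trans (hD.mk_graph_le α)

theorem mk_setOf_isDirectHit_le (hD : D.Good) (h : ∀ β < α, #(D.level β) ≤ D.m) :
    #{s | D.IsDirectHit D.level α s} ≤ D.m := by
  -- The graph at `γ` records only points strictly below `γ`, so reading off `P δ α` needs `γ` above
  -- α.
  obtain ⟨γ, hγ⟩ := hD.exists_bound {α} (by simpa using one_le_aleph0.trans hD.aleph0_le)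
  have hαγ : α < γ := hγ α rfl
  let 𝒯 : Set (Set (Set K)) := {𝒜 | ∃ δ ∈ D.S, α ∈ D.N δ ∧ 𝒜 = D.P δ α}
  have h𝒯 : #𝒯 ≤ D.m := by
    refine (mk_le_of_forall_exists_unique (q := D.graph γ '' {δ | δ ∈ D.S ∧ α ∈ D.N δ})
      (fun g 𝒜 => ∀ ℬ, (α, ℬ) ∈ g ↔ ℬ = 𝒜) ?_ ?_).trans
      ((mk_le_mk_of_subset (image_mono fun δ hδ => hδ.1)).trans (hD.mk_graph_le γ))
    · rintro _ ⟨δ, hδ, hα, rfl⟩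
      exact ⟨_, ⟨δ, ⟨hδ, hα⟩, rfl⟩, fun ℬ => by simp [mem_graph, hα, hαγ]⟩
    · intro g 𝒜 _ 𝒜' _ h1 h2
      exact (h2 𝒜).1 ((h1 𝒜).2 rfl)
  refine (mk_le_mk_of_subset (t := (fun q : (K × Set K) × Set (Set K) =>
    D.directHit D.level α q.1.1 q.1.2 q.2) ''
      ({p : K × Set K | p.1 < α ∧ p.2 ∈ D.level p.1} ×ˢ (insert ∅ 𝒯))) ?_).trans ?_
  · rintro s ⟨η, hη, x, hx, 𝒜, h𝒜, rfl⟩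
    exact ⟨((η, x), 𝒜), ⟨⟨hη, hx⟩, h𝒜⟩, rfl⟩
  · refine mk_image_le.trans ?_
    rw [mk_setProd]
    refine (mul_le_mul' (mk_setOf_lt_le hD.aleph0_le (hD.mk_Iio_le α) h) ?_).trans_eq
      (mul_eq_self hD.aleph0_le)
    exact mk_insert_le.trans (add_le_of_le hD.aleph0_le h𝒯 (one_le_aleph0.trans hD.aleph0_le))

/-- At cofinality `m` the canonical branches are counted. Elsewhere a branch is determined by its
traces on a cofinal set of size below `m`, and `power_le` applies. -/
theorem mk_level_le (hD : D.Good) (α : K) : #(D.level α) ≤ D.m := by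
  induction α using WellFoundedLT.induction with
  | ind α ih =>
    by_cases hα : Order.cof (Iio α) = D.m
    · refine (mk_le_mk_of_subset (t := {s | s ⊆ Iio α ∧ D.IsClimbLimit D.level α s} ∪
        {s | D.IsDirectHit D.level α s}) fun s hs => ?_).trans ((mk_union_le _ _).trans
        (add_le_of_le hD.aleph0_le (hD.mk_setOf_isClimbLimit_le ih)
          (hD.mk_setOf_isDirectHit_le ih)))
      have hsub := subset_Iio_of_mem_level hs
      rw [level_eq] at hs
      exact (hs.2 hα).imp (fun h => ⟨hsub, h⟩) fun h => h.2
    · obtain ⟨C, hC, hCcard⟩ := Order.exists_cof_eq (α := Iio α)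
      let B : Set (Set K) := ⋃ β ∈ Iio α, D.level β
      have hB : #(B × Prop) ≤ D.m := by
        rw [mk_prod]
        simp only [lift_uzero, mk_Prop, lift_ofNat]
        exact mul_le_of_le hD.aleph0_le (mk_biUnion_level_le hD.aleph0_le (hD.mk_Iio_le α) ih)
          ((natCast_lt_aleph0 (n := 2)).le.trans hD.aleph0_le)
      -- The `Prop` coordinate records membership of the point `c` itself, which its trace on `Iio
      -- c` misses; this matters when α is a successor.
      let f : D.level α → C → B × Prop := fun s c =>
        (⟨s.1 ∩ Iio c.1.1, mem_biUnion c.1.2 (inter_mem_level s.2 (le_of_lt c.1.2))⟩, c.1.1 ∈ s.1)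
      have hf : Function.Injective f := by
        rintro ⟨s, hs⟩ ⟨s', hs'⟩ hss
        refine Subtype.ext (Set.ext fun t => ?_)
        by_cases ht : t < α
        · obtain ⟨c, hc, htc⟩ := hC ⟨t, ht⟩
          have hc' := congrFun hss ⟨c, hc⟩
          rcases (show t ≤ c.1 from htc).lt_or_eq with htc | htc
          · have h1 : s ∩ Iio c.1 = s' ∩ Iio c.1 :=
              congrArg Subtype.val (congrArg Prod.fst hc')
            have := congrArg (t ∈ ·) h1
            simpa [htc] using this
          · have h1 : (c.1 ∈ s) = (c.1 ∈ s') := congrArg Prod.snd hc'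
            rw [htc, h1]
        · exact iff_of_false (fun h => ht (subset_Iio_of_mem_level hs h))
            fun h => ht (subset_Iio_of_mem_level hs' h)
      refine (mk_le_of_injective hf).trans ?_
      rw [← power_def, hCcard]
      exact (power_le_power_right hB).trans
        (hD.power_le _ ((hD.cof_Iio_le α).lt_of_ne hα))

end Good

end GuessingSystem

/-! ### The tree of nodes, its antichains and its chains -/

theorem exists_maximal_antichain {T : Type*} (r : T → T → Prop) {A : Set T}
    (hA : IsAntichain r A) :
    ∃ B, A ⊆ B ∧ IsAntichain r B ∧ ∀ z, ∃ w ∈ B, r z w ∨ w = z ∨ r w z := by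
  obtain ⟨B, hAB, hB⟩ := zorn_subset_nonempty {B | IsAntichain r B} (fun c hc hchain _ =>
    ⟨⋃₀ c, by
      rintro a ⟨s, hs, has⟩ b ⟨t, ht, hbt⟩ hab
      rcases hchain.total hs ht with h | h
      · exact hc ht (h has) hbt hab
      · exact hc hs has (h hbt) hab, fun s hs => subset_sUnion_of_mem hs⟩) A hA
  refine ⟨B, hAB, hB.prop, fun z => ?_⟩
  by_contra! H
  have hz : IsAntichain r (insert z B) := by
    rintro a (rfl | ha) b (rfl | hb) hab
    · exact (hab rfl).elim
    · exact (H b hb).1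
    · exact (H a ha).2.2
    · exact hB.prop ha hb hab
  exact (H z (hB.le_of_ge hz (subset_insert z B) (mem_insert z B))).2.1 rfl

namespace GuessingSystem

variable {K : Type v} [LinearOrder K] {D : GuessingSystem K} {α : K} [WellFoundedLT K]

variable (D) in
/-- The nodes of the tree. -/
def Node : Type v := {p : K × Set K // p.2 ∈ D.level p.1}

variable (D) in
/-- The tree order: end-extension. -/
def nodeLT (p q : D.Node) : Prop := p.1.1 < q.1.1 ∧ q.1.2 ∩ Iio p.1.1 = p.1.2

theorem nodeLT_irrefl (p : D.Node) : ¬ D.nodeLT p p := fun h => lt_irrefl _ h.1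

theorem nodeLT_trans {p q r : D.Node} (h : D.nodeLT p q) (h' : D.nodeLT q r) : D.nodeLT p r :=
  ⟨h.1.trans h'.1, by rw [← inter_inter_Iio h.1.le, h'.2, h.2]⟩

variable (D) in
/-- The predecessors of a node are isomorphic to its level. -/
def predIso (x : D.Node) :
    (fun a b : {y // D.nodeLT y x} => D.nodeLT a b) ≃r (fun a b : Iio x.1.1 => a < b) where
  toFun y := ⟨y.1.1.1, y.2.1⟩
  invFun β := ⟨⟨(β.1, x.1.2 ∩ Iio β.1), inter_mem_level x.2 (le_of_lt β.2)⟩, β.2, rfl⟩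
  left_inv y := Subtype.ext (Subtype.ext (Prod.ext rfl y.2.2))
  right_inv β := rfl
  map_rel_iff' {a b} := by
    refine ⟨fun h => ⟨h, ?_⟩, fun h => h.1⟩
    have h' : a.1.1.1 < b.1.1.1 := h
    rw [← b.2.2, inter_inter_Iio h'.le, a.2.2]

namespace Good

theorem mk_setOf_node_lt_le (hD : D.Good) (α : K) : #{p : D.Node | p.1.1 < α} ≤ D.m :=
  (mk_le_of_injective (f := fun p : {p : D.Node | p.1.1 < α} =>
    (⟨p.1.1, p.2, p.1.2⟩ : {p : K × Set K | p.1 < α ∧ p.2 ∈ D.level p.1}))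
    fun p q h => Subtype.ext (Subtype.ext (by simpa using h))).trans
  (mk_setOf_lt_le hD.aleph0_le (hD.mk_Iio_le α) fun β _ => hD.mk_level_le β)

theorem exists_club_closed (hD : D.Good) (F : D.Node → K) :
    ∃ E : Set K, IsClub E ∧ ∀ α ∈ E, ∀ p : D.Node, p.1.1 < α → F p < α := by
  have : ∀ β : K, ∃ b, ∀ p : D.Node, p.1.1 = β → F p < b := fun β => by
    obtain ⟨γ, hγ⟩ := hD.exists_bound {β} (by simpa using one_le_aleph0.trans hD.aleph0_le)
    obtain ⟨b, hb⟩ := hD.exists_bound (F '' {p | p.1.1 < γ})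
      (mk_image_le.trans (hD.mk_setOf_node_lt_le γ))
    exact ⟨b, fun p hp => hb _ ⟨p, hp.trans_lt (hγ β rfl), rfl⟩⟩
  choose G hG using this
  exact ⟨_, isClub_setOf_forall_lt hD.aleph0_le hD.mk_Iio_le hD.exists_bound G,
    fun α hα p hp => (hG _ p rfl).trans (hα _ hp)⟩

/-- On a level in `S` the node `y` is a climb limit along some δ'. By coherence that climb uses the
family `P δ α` at a guessing point α, and there `next` meets `A ∩ Iio α`. -/
theorem exists_hits (hD : D.Good) {δ : K} (hδ : δ ∈ D.S) {A E : Set K}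
    (hguess : ∀ β < δ, ∃ α ∈ D.N δ, β < α ∧ A ∩ Iio α ∈ D.P δ α ∧ α ∈ E)
    (hpre : ∀ α ∈ E, D.Predense D.level α (A ∩ Iio α)) {y : Set K} (hy : y ∈ D.level δ) :
    ∃ β < δ, D.code (β, y ∩ Iio β) ∈ A := by
  have hy' := hy
  rw [level_eq] at hy'
  obtain ⟨η, hη, hx, δ', hδ', hlim, hclimb⟩ :=
    (hy'.2 (hD.cof_eq δ hδ)).resolve_right fun h => h.1 hδ
  obtain ⟨α₀, hα₀, hcoh⟩ := hD.coherent δ hδ δ' hδ' hlim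
  -- The guess is taken past both the start `η` of the climb and the bound `α₀` beyond which the two
  -- sequences agree.
  obtain ⟨α, hα, hβα, hAα, hαE⟩ := hguess (max α₀ η) (max_lt hα₀ hη)
  obtain ⟨hα', hP⟩ := hcoh α hα ((le_max_left _ _).trans_lt hβα)
  have hαδ := hD.lt_of_mem δ hδ α hα
  have hηα : η < α := (le_max_right _ _).trans_lt hβα
  obtain ⟨ρ, hρ⟩ := exists_isLUB_of_bddAbove (s := insert η {β | β < α ∧ β ∈ D.N δ'}) ⟨α, by
    rintro τ (rfl | hτ)
    · exact hηα.le
    · exact hτ.1.le⟩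
  have hρα := hD.lt_of_isLUB hδ' hα' hηα hρ
  have hstep := hclimb α _ (mem_graph.2 ⟨hα', hαδ, rfl⟩) hηα ρ
    (by rwa [setOf_exists_mem_graph hαδ.le])
  obtain ⟨-, -, hhit⟩ := (hD.extends_and_hitsAt α).2.next_spec hδ' hα' hρα
    (inter_mem_level hy (hρα.trans hαδ).le)
  rw [← hstep, ← hP] at hhit
  obtain ⟨β, hβ, hβA⟩ := hhit _ hAα (hpre α hαE)
  rw [inter_inter_Iio hβ.le] at hβA
  exact ⟨β, hβ.trans hαδ, hβA.1⟩

/-- Nodes on level δ already lie above members of the maximal antichain from lower levels, so no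
member has level δ or more. -/
theorem mk_antichain_le (hD : D.Good) {A : Set D.Node} (hA : IsAntichain D.nodeLT A) :
    #A ≤ D.m := by
  obtain ⟨B, hAB, hB, hmax⟩ := exists_maximal_antichain _ hA
  refine (mk_le_mk_of_subset hAB).trans ?_
  choose W hWB hW using hmax
  -- For α in `E`, every node below α is comparable with a member `W p` of `B` whose level is below
  -- α; applying closure again to `W p` puts its code below α too.
  obtain ⟨E, hE, hEF⟩ := hD.exists_club_closed fun p => max (D.code p.1) (W p).1.1
  obtain ⟨δ, hδ, hguess⟩ := hD.guess ((fun p : D.Node => D.code p.1) '' B) E hE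
  have hpre : ∀ α ∈ E, D.Predense D.level α (((fun p : D.Node => D.code p.1) '' B) ∩ Iio α) := by
    intro α hα β hβ z hz
    let p : D.Node := ⟨(β, z), hz⟩
    have hWα : (W p).1.1 < α := (le_max_right _ _).trans_lt (hEF α hα p hβ)
    have hcode : D.code (W p).1 < α := (le_max_left _ _).trans_lt (hEF α hα (W p) hWα)
    have hmem : D.code ((W p).1.1, (W p).1.2) ∈ ((fun p : D.Node => D.code p.1) '' B) ∩ Iio α :=
      ⟨⟨W p, hWB p, rfl⟩, hcode⟩
    rcases hW p with h | h | h
    · exact ⟨_, hWα, h.1.le, _, (W p).2, h.2, _, le_rfl, by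
        rwa [inter_Iio_of_mem_level (W p).2]⟩
    · refine ⟨β, hβ, le_rfl, z, hz, inter_Iio_of_mem_level hz, β, le_rfl, ?_⟩
      rw [h] at hmem
      rwa [inter_Iio_of_mem_level hz]
    · refine ⟨β, hβ, le_rfl, z, hz, inter_Iio_of_mem_level hz, _, le_of_lt h.1, ?_⟩
      rwa [show z ∩ Iio (W p).1.1 = (W p).1.2 from h.2]
  refine (mk_le_mk_of_subset fun w hw => ?_).trans (hD.mk_setOf_node_lt_le δ)
  by_contra! hlt
  replace hlt : δ ≤ w.1.1 := not_lt.1 hlt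
  obtain ⟨β, hβ, ⟨w', hw', hcode⟩⟩ := hD.exists_hits hδ hguess hpre (inter_mem_level w.2 hlt)
  rw [inter_inter_Iio hβ.le] at hcode
  have heq : w'.1 = (β, w.1.2 ∩ Iio β) :=
    hD.code_injOn (subset_Iio_of_mem_level w'.2) inter_subset_right hcode
  have hlt' : D.nodeLT w' w := by
    rw [nodeLT, heq]
    exact ⟨hβ.trans_le hlt, rfl⟩
  refine hB hw' hw ?_ hlt'
  rintro rfl
  exact lt_irrefl _ hlt'.1

theorem exists_mem_level (hD : D.Good) (α : K) : ∃ s, s ∈ D.level α := by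
  by_cases h : ∃ β, β < α
  · obtain ⟨β, hβ⟩ := h
    have : Nonempty K := ⟨α⟩
    obtain ⟨b, hb⟩ := WellFounded.has_min (wellFounded_lt (α := K)) univ univ_nonempty
    have h0 : (∅ : Set K) ∈ D.level b := by
      refine IsBranch.mem_level ⟨empty_subset _, fun γ hγ => (hb.2 γ trivial hγ).elim⟩ ?_
      have : IsEmpty (Iio b) := ⟨fun γ => hb.2 γ.1 trivial γ.2⟩
      rw [Order.cof_eq_zero]
      exact (aleph0_pos.trans_le hD.aleph0_le).ne
    obtain ⟨y, hy, -⟩ := (hD.extends_and_hitsAt α).1 b (not_lt.1 (hb.2 α trivial)) ∅ h0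
    exact ⟨y, hy⟩
  · push Not at h
    refine ⟨∅, IsBranch.mem_level ⟨empty_subset _, fun β hβ => ((h β).not_gt hβ).elim⟩ ?_⟩
    have : IsEmpty (Iio α) := ⟨fun γ => (h γ.1).not_gt γ.2⟩
    rw [Order.cof_eq_zero]
    exact (aleph0_pos.trans_le hD.aleph0_le).ne

/-- Off a cofinal branch there is an antichain of size `#K`. -/
theorem mk_le_of_forall_inter_mem_level (hD : D.Good) {B : Set K}
    (hB : ∀ β, B ∩ Iio β ∈ D.level β) : #K ≤ D.m := by
  have hsucc : ∀ β : K, ∃ γ, β < γ ∧ ∀ t < γ, t ≤ β := fun β => by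
    obtain ⟨b, hb⟩ := hD.exists_bound {β} (by simpa using one_le_aleph0.trans hD.aleph0_le)
    obtain ⟨γ, hγ, hmin⟩ := WellFounded.has_min (wellFounded_lt (α := K)) (Ioi β) ⟨b, hb β rfl⟩
    exact ⟨γ, hγ, fun t ht => not_lt.1 fun h => hmin t h ht⟩
  choose σ hσ hσ' using hsucc
  -- `a β` follows `B` below `β` and then takes the opposite decision at `β`; it lies on the
  -- successor level `σ β`.
  let a : K → Set K := fun β => (B ∩ Iio β) ∪ ({β} \ B)
  have haβ : ∀ β, a β ∩ Iio β = B ∩ Iio β := fun β => by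
    ext t
    simp only [a, mem_inter_iff, mem_union, mem_Iio, mem_sdiff, mem_singleton_iff]
    constructor
    · rintro ⟨h | ⟨rfl, -⟩, h'⟩
      · exact h
      · exact (lt_irrefl _ h').elim
    · exact fun h => ⟨Or.inl h, h.2⟩
  have haσ : ∀ β, a β ∩ Iio (σ β) = a β := fun β => inter_eq_left.2 (by
    rintro t (h | h)
    · exact h.2.trans (hσ β)
    · exact h.1.symm ▸ hσ β)
  have ha : ∀ β, a β ∈ D.level (σ β) := fun β => by
    refine IsBranch.mem_level ⟨inter_eq_left.1 (haσ β), fun γ hγ => ?_⟩ ?_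
    · rw [← inter_inter_Iio (hσ' β γ hγ), haβ, inter_inter_Iio (hσ' β γ hγ)]
      exact hB γ
    · refine ((cof_Iio_le_mk (ι := PUnit) (f := fun _ => β) (fun _ => hσ β)
        fun t ht => ⟨⟨⟩, hσ' β t ht⟩).trans_lt ?_).ne
      exact (by simpa using one_lt_aleph0.trans_le hD.aleph0_le)
  have hne : ∀ β, a β ≠ B ∩ Iio (σ β) := fun β h => by
    have := congrArg (β ∈ ·) h
    simp [a, hσ β] at this
  have hmono : ∀ β γ, σ β < σ γ → a γ ∩ Iio (σ β) ≠ a β := fun β γ h => by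
    have hle := hσ' γ _ h
    rw [← inter_inter_Iio hle, haβ, inter_inter_Iio hle]
    exact (hne β).symm
  let f : K → D.Node := fun β => ⟨(σ β, a β), ha β⟩
  have hf : Function.Injective f := fun β γ h => by
    have h1 : σ β = σ γ := congrArg (fun p : D.Node => p.1.1) h
    exact le_antisymm (hσ' γ β (h1 ▸ hσ β)) (hσ' β γ (h1 ▸ hσ γ))
  have hanti : IsAntichain D.nodeLT (range f) := by
    rintro _ ⟨β, rfl⟩ _ ⟨γ, rfl⟩ - h
    exact hmono β γ h.1 h.2
  rw [← mk_range_eq f hf]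
  exact hD.mk_antichain_le hanti

/-- A chain of bounded height lies among at most `m` nodes; the union of an unbounded one would be a
cofinal branch. -/
theorem mk_chain_le (hD : D.Good) (hK : D.m < #K) {C : Set D.Node} (hC : IsChain D.nodeLT C) :
    #C ≤ D.m := by
  by_cases hb : ∃ b, ∀ p ∈ C, p.1.1 < b
  · obtain ⟨b, hb⟩ := hb
    exact (mk_le_mk_of_subset hb).trans (hD.mk_setOf_node_lt_le b)
  · push Not at hb
    refine (hK.not_ge (hD.mk_le_of_forall_inter_mem_level (B := ⋃ p : C, p.1.1.2) fun β => ?_)).elim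
    have hcoh : ∀ p q : C, p.1.1.1 ≤ q.1.1.1 → q.1.1.2 ∩ Iio p.1.1.1 = p.1.1.2 := by
      intro p q hpq
      by_cases h : p = q
      · subst h
        exact inter_Iio_of_mem_level p.1.2
      · rcases hC p.2 q.2 (fun h' => h (Subtype.ext h')) with h' | h'
        · exact h'.2
        · exact (hpq.not_gt h'.1).elim
    obtain ⟨p, hp, hβp⟩ := hb β
    have := iUnion_inter_Iio (ℓ := fun p : C => p.1.1.1) (w := fun p : C => p.1.1.2) hcoh ⟨p, hp⟩
    rw [← inter_inter_Iio hβp, this]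
    exact inter_mem_level p.2 hβp

theorem exists_node_upper_bound (hD : D.Good) {ι : Type v} [LinearOrder ι] (hι : #ι < D.m)
    (f : ι → D.Node) (hf : ∀ i j, i < j → D.nodeLT (f i) (f j)) :
    ∃ p, ∀ i, f i = p ∨ D.nodeLT (f i) p := by
  obtain ⟨b, hb⟩ := hD.exists_bound (range fun i => (f i).1.1) (mk_range_le.trans hι.le)
  obtain ⟨ρ, hρ⟩ := exists_isLUB_of_bddAbove ⟨b, fun t ht => (hb t ht).le⟩
  have hcoh := coherent_of_lt (ℓ := fun i => (f i).1.1) (w := fun i => (f i).1.2)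
    (fun i => subset_Iio_of_mem_level (f i).2) fun i j hij => ⟨(hf i j hij).1.le, (hf i j hij).2⟩
  refine ⟨⟨(ρ, _), iUnion_mem_level (fun i => (f i).2) hcoh hρ hι⟩, fun i => ?_⟩
  have h := iUnion_inter_Iio hcoh i
  rcases (hρ.1 ⟨i, rfl⟩ : (f i).1.1 ≤ ρ).lt_or_eq with hlt | heq
  · exact Or.inr ⟨hlt, h⟩
  · refine Or.inl (Subtype.ext (Prod.ext heq ?_))
    rw [← h, heq]
    refine inter_eq_left.2 (iUnion_subset fun j => (subset_Iio_of_mem_level (f j).2).trans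
      (Iio_subset_Iio (hρ.1 ⟨j, rfl⟩)))

theorem mk_node (hD : D.Good) (hK : D.m ≤ #K) : #D.Node = #K := by
  refine le_antisymm ?_ ?_
  · have hsub : (univ : Set D.Node) = ⋃ α : K, {p : D.Node | p.1.1 = α} := by
      ext p; simp
    rw [← mk_univ, hsub]
    refine (mk_iUnion_le _).trans ((mul_le_mul' le_rfl (ciSup_le' (a := #K) fun α => ?_)).trans_eq
      (mul_eq_self (hD.aleph0_le.trans hK)))
    obtain ⟨b, hb⟩ := hD.exists_bound {α} (by simpa using one_le_aleph0.trans hD.aleph0_le)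
    refine ((mk_le_mk_of_subset ?_).trans (hD.mk_setOf_node_lt_le b)).trans hK
    rintro p rfl
    exact hb _ rfl
  · choose s hs using hD.exists_mem_level
    exact mk_le_of_injective (f := fun α => (⟨(α, s α), hs α⟩ : D.Node)) fun α β h =>
      congrArg (fun p : D.Node => p.1.1) h

end Good

end GuessingSystem

/-! ### The ordinals below `κ` as the underlying well-order -/

section Below

variable {κ : Cardinal.{u}}

/-- The initial segment of `Below κ` given by `α` is the set of ordinals smaller than `α`. -/
def Below.iioIso (α : Below κ) : Iio α ≃o Iio α.1 where
  toFun x := ⟨x.1.1, x.2⟩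
  invFun y := ⟨⟨y.1, (mem_Iio.1 y.2).trans α.2⟩, y.2⟩
  left_inv _ := rfl
  right_inv _ := rfl
  map_rel_iff' := Iff.rfl

theorem Below.cof_Iio (α : Below κ) : Order.cof (Iio α) = lift.{u + 1} α.1.cof := by
  rw [(Below.iioIso α).cof_congr, Ordinal.cof_Iio, Ordinal.lift_cof]

theorem Below.mk_Iio (α : Below κ) : #(Iio α) = lift.{u + 1} α.1.card := by
  rw [(Below.iioIso α).toEquiv.cardinal_eq, mk_Iio_ordinal]

theorem Below.mk_eq (κ : Cardinal.{u}) : #(Below κ) = lift.{u + 1} κ := by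
  rw [mk_Iio_ordinal, card_ord]

/-- The least element of `C` above `β` cannot accumulate `C`, so the non-accumulation points are
already cofinal. -/
theorem isLimitOf_nacc {C : Set (Below κ)} {α : Below κ} (hα : α ∈ acc C) :
    IsLimitOf (nacc C) α := by
  have h0 : (0 : Ordinal) < α.1 := pos_iff_ne_zero.2 hα.1
  refine ⟨⟨⟨0, h0.trans α.2⟩, h0⟩, fun β hβ => ?_⟩
  obtain ⟨γ, ⟨hγ, hβγ⟩, hmin⟩ := WellFounded.has_min (wellFounded_lt (α := Below κ))
    {γ | γ ∈ C ∧ β < γ} (by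
      obtain ⟨γ, hγ, h1, -⟩ := hα.2 β hβ
      exact ⟨γ, hγ, h1⟩)
  refine ⟨γ, ⟨hγ, fun hacc => ?_⟩, hβγ, ?_⟩
  · obtain ⟨τ, hτ, h1, h2⟩ := hacc.2 β hβγ
    exact hmin τ ⟨hτ, h1⟩ h2
  · obtain ⟨τ, hτ, h1, h2⟩ := hα.2 β hβ
    exact (not_lt.1 (hmin τ ⟨hτ, h1⟩)).trans_lt h2

theorem IsLimitOf.mem_acc {C : Set (Below κ)} {α : Below κ} (hα : IsLimitOf (nacc C) α) :
    α ∈ acc C := by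
  obtain ⟨⟨β, hβ⟩, h⟩ := hα
  refine ⟨(zero_le.trans_lt (show β.1 < α.1 from hβ)).ne', fun β hβ => ?_⟩
  obtain ⟨γ, hγ, h1⟩ := h β hβ
  exact ⟨γ, hγ.1, h1⟩

theorem Below.exists_bound {μ : Cardinal.{u}} (hμ : ℵ₀ ≤ μ) (hκ : κ = Order.succ μ)
    (s : Set (Below κ)) (hs : #s ≤ lift.{u + 1} μ) : ∃ b, ∀ t ∈ s, t < b := by
  refine not_isCofinal_iff.1 fun h => (Order.cof_le h).not_gt (hs.trans_lt ?_)
  rw [Ordinal.cof_Iio, ← Ordinal.lift_cof, hκ, (isRegular_succ hμ).cof_ord, lift_lt]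
  exact Order.lt_succ μ

/-- There are `κ` bounds and at most `2 ^ μ = κ` subsets below each. -/
theorem Below.exists_code {μ : Cardinal.{u}} (hμ : ℵ₀ ≤ μ) (hκ : κ = Order.succ μ)
    (hκ' : κ = 2 ^ μ) : ∃ code : Below κ × Set (Below κ) → Below κ,
      InjOn code {p | p.2 ⊆ Iio p.1} := by
  have hle : ∀ α : Below κ, #(Iio α) ≤ lift.{u + 1} μ := fun α => by
    rw [Below.mk_Iio, lift_le]
    exact Order.lt_succ_iff.1 (hκ ▸ lt_ord.1 α.2)
  have hκ0 : ℵ₀ ≤ lift.{u + 1} κ := by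
    rw [aleph0_le_lift, hκ]
    exact hμ.trans (Order.le_succ μ)
  have hcard : #{p : Below κ × Set (Below κ) | p.2 ⊆ Iio p.1} ≤ #(Below κ) := by
    refine (mk_le_mk_of_subset (t := ⋃ α : Below κ, Prod.mk α '' 𝒫 (Iio α)) ?_).trans ?_
    · rintro ⟨α, s⟩ h
      exact mem_iUnion.2 ⟨α, s, h, rfl⟩
    · refine (mk_iUnion_le _).trans ((mul_le_mul' le_rfl
        (ciSup_le' (a := #(Below κ)) fun α => ?_)).trans_eq (mul_eq_self (by rwa [Below.mk_eq])))
      refine mk_image_le.trans ?_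
      rw [mk_powerset, Below.mk_eq]
      refine (power_le_power_left two_ne_zero (hle α)).trans_eq ?_
      rw [← lift_two.{u + 1, u}, ← lift_power, ← hκ']
  obtain ⟨⟨f, hf⟩⟩ := hcard
  classical
  have : Nonempty (Below κ) := ⟨⟨0, by
    rw [mem_Iio, lt_ord, Ordinal.card_zero, hκ]
    exact Order.bot_lt_succ μ⟩⟩
  refine ⟨fun p => if h : p ∈ {p : Below κ × Set (Below κ) | p.2 ⊆ Iio p.1} then f ⟨p, h⟩
    else Classical.arbitrary _, fun p hp q hq h => ?_⟩
  simp only [dif_pos hp, dif_pos hq] at h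
  exact congrArg Subtype.val (hf h)

end Below

/-! ### Renaming the nodes by ordinals, and the theorem -/

namespace GuessingSystem

variable {κ : Cardinal.{u}} {D : GuessingSystem (Below κ)}

/-- The predecessors of a node, after a renaming of the nodes by the elements of `Below κ`. -/
noncomputable def renamedPredIso (e : D.Node ≃ Below κ) (x : Below κ) :
    (fun a b : {y // D.nodeLT (e.symm y) (e.symm x)} => D.nodeLT (e.symm a) (e.symm b)) ≃r
      (fun a b : Iio (e.symm x).1.1.1 => a < b) :=
  ({ toFun := fun y => ⟨e.symm y.1, y.2⟩
     invFun := fun p => ⟨e p.1, by simpa using p.2⟩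
     left_inv := fun y => by simp
     right_inv := fun p => by simp
     map_rel_iff' := Iff.rfl } :
    (fun a b : {y // D.nodeLT (e.symm y) (e.symm x)} => D.nodeLT (e.symm a) (e.symm b)) ≃r
      (fun a b : {p // D.nodeLT p (e.symm x)} => D.nodeLT a b)).trans
  ((D.predIso (e.symm x)).trans (Below.iioIso (e.symm x).1.1).toRelIsoLT)

theorem Good.isSouslinTree (hD : D.Good) {μ : Cardinal.{u}} (hm : D.m = lift.{u + 1} μ)
    (hμκ : μ < κ) (e : D.Node ≃ Below κ) :
    IsSouslinTree κ fun a b => D.nodeLT (e.symm a) (e.symm b) where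
  tree :=
    { irrefl := fun x => nodeLT_irrefl _
      trans := fun x y z => nodeLT_trans
      wellOrder_pred := fun x => (renamedPredIso e x).toRelEmbedding.isWellOrder }
  level_lt x := ⟨_, (e.symm x).1.1.2, ⟨renamedPredIso e x⟩⟩
  level_nonempty β hβ := by
    obtain ⟨s, hs⟩ := hD.exists_mem_level ⟨β, hβ⟩
    let p : D.Node := ⟨(⟨β, hβ⟩, s), hs⟩
    refine ⟨e p, ?_⟩
    have h := renamedPredIso e (e p)
    rw [show (e.symm (e p)).1.1.1 = β by rw [e.symm_apply_apply]] at h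
    exact ⟨h⟩
  chain_lt C hC := by
    have hlt : D.m < #(Below κ) := by rwa [Below.mk_eq, hm, lift_lt]
    have h := hD.mk_chain_le hlt (C := e ⁻¹' C) fun p hp q hq hpq => by
      simpa using hC hp hq (e.injective.ne hpq)
    rw [mk_preimage_equiv] at h
    rw [lift_id'.{u, u + 1}]
    exact h.trans_lt (by rwa [hm, lift_lt])
  antichain_lt A hA := by
    have h := hD.mk_antichain_le (A := e ⁻¹' A) fun p hp q hq hpq => by
      simpa using hA hp hq (e.injective.ne hpq)
    rw [mk_preimage_equiv] at h
    rw [lift_id'.{u, u + 1}]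
    exact h.trans_lt (by rwa [hm, lift_lt])

theorem Good.isCompleteTree (hD : D.Good) {μ : Cardinal.{u}} (hm : D.m = lift.{u + 1} μ)
    (e : D.Node ≃ Below κ) :
    IsCompleteTree μ fun a b => D.nodeLT (e.symm a) (e.symm b) := by
  intro o ho s hs
  obtain ⟨p, hp⟩ := hD.exists_node_upper_bound (ι := Iio o)
    (by rwa [mk_Iio_ordinal, hm, lift_lt, ← lt_ord]) (fun i => e.symm (s i)) hs
  refine ⟨e p, fun i => ?_⟩
  simpa [Equiv.symm_apply_eq] using hp i

end GuessingSystem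

theorem theorem2 (μ κ : Cardinal.{u}) (hμ : Cardinal.aleph0 ≤ μ)
    (hκ : κ = Order.succ μ) (hκ' : κ = 2 ^ μ) (hpow : μ = Cardinal.powerlt μ μ)
    (S : Set (Below κ)) (c : Below κ → Set (Below κ))
    (P : Below κ → Below κ → Set (Set (Below κ)))
    -- a sequence of closed cofinal sets of limit ordinals
    (hS : ∀ δ ∈ S, δ.1.cof = μ)
    (hc_below : ∀ δ ∈ S, c δ ⊆ Set.Iio δ)
    (hc_sup : ∀ δ ∈ S, IsLUB (c δ) δ)
    (hc_closed : ∀ δ ∈ S, ∀ α ∈ acc (c δ), α < δ → α ∈ c δ)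
    (hc_limit : ∀ δ ∈ S, ∀ α ∈ c δ, Order.IsSuccLimit α.1)
    -- small guessing families
    (hP_sub : ∀ δ ∈ S, ∀ α ∈ nacc (c δ), ∀ X ∈ P δ α, X ⊆ Set.Iio α)
    (hP_card : ∀ δ ∈ S, ∀ α ∈ nacc (c δ),
      Cardinal.mk (P δ α) ≤ Cardinal.lift.{u + 1} α.1.cof)
    (hP_card' : ∀ δ ∈ S, ∀ α ∈ nacc (c δ), α ∈ S →
      Cardinal.mk (P δ α) < Cardinal.lift.{u + 1} μ)
    -- prediction
    (hguess : ∀ A E : Set (Below κ), IsClub E →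
      ∃ S' ⊆ S, IsStationary S' ∧ ∀ δ ∈ S',
        IsLUB {α | α ∈ nacc (c δ) ∧ A ∩ Set.Iio α ∈ P δ α ∧ α ∈ E} δ)
    -- coherence at accumulation points
    (hcoh : ∀ δ ∈ S, ∀ δ' ∈ S, δ ∈ acc (c δ') →
      ∃ α < δ, ∀ β ∈ nacc (c δ), α < β → β ∈ nacc (c δ') ∧ P δ β = P δ' β)
    -- few initial segments
    (hsmall : ∀ γ : Below κ,
      Cardinal.mk (guessSeq c P γ '' S) ≤ Cardinal.lift.{u + 1} μ) :
    ∃ r : Below κ → Below κ → Prop, IsSouslinTree κ r ∧ IsCompleteTree μ r := by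
  have hμκ : μ < κ := hκ ▸ Order.lt_succ μ
  obtain ⟨code, hcode⟩ := Below.exists_code hμ hκ hκ'
  let D : GuessingSystem (Below κ) :=
    { m := lift.{u + 1} μ, S := S, N := fun δ => nacc (c δ), P := P, code := code }
  have hacc : ∀ δ ∈ S, δ ∈ acc (c δ) := by
    refine fun δ hδ => ⟨fun h => ?_, fun β hβ => ?_⟩
    · have := hS δ hδ
      rw [h, Ordinal.cof_zero] at this
      exact (aleph0_pos.trans_le hμ).ne this
    · obtain ⟨γ, hγ, h1, -⟩ := (hc_sup δ hδ).exists_between hβ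
      exact ⟨γ, hγ, h1, hc_below δ hδ hγ⟩
  have hD : D.Good :=
    { aleph0_le := aleph0_le_lift.2 hμ
      mk_Iio_le := fun α => by
        rw [Below.mk_Iio]
        exact lift_le.2 (Order.lt_succ_iff.1 (hκ ▸ lt_ord.1 α.2))
      power_le := fun a ha => by
        obtain ⟨b, hb, rfl⟩ := lt_lift_iff.1 ha
        change lift μ ^ lift b ≤ lift μ
        rw [← lift_power, lift_le]
        exact (le_powerlt μ hb).trans_eq hpow.symm
      cof_eq := fun δ hδ => by rw [Below.cof_Iio, hS δ hδ]
      lt_of_mem := fun δ hδ α hα => hc_below δ hδ hα.1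
      isLimitOf := fun δ hδ => isLimitOf_nacc (hacc δ hδ)
      not_isLimitOf := fun δ hδ α hα h => hα.2 h.mem_acc
      aleph0_le_cof := fun δ hδ α hα => by
        rw [Below.cof_Iio, aleph0_le_lift, Ordinal.aleph0_le_cof_iff, Ordinal.one_lt_cof_iff]
        exact hc_limit δ hδ α hα.1
      mk_le := fun δ hδ α hα => by
        rw [Below.cof_Iio]
        exact hP_card δ hδ α hα
      mk_lt := hP_card'
      mk_graph_le := hsmall
      coherent := fun δ hδ δ' hδ' h => hcoh δ hδ δ' hδ' h.mem_acc
      exists_bound := Below.exists_bound hμ hκ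
      code_injOn := hcode
      guess := fun A E hE => by
        obtain ⟨S', hS', hstat, hlub⟩ := hguess A E hE
        -- A single guessing level suffices to bound an antichain.
        obtain ⟨δ, hδ⟩ := hstat.nonempty
        refine ⟨δ, hS' hδ, fun β hβ => ?_⟩
        obtain ⟨α, ⟨hα, hA, hE⟩, h, -⟩ := (hlub δ hδ).exists_between hβ
        exact ⟨α, hα, h, hA, hE⟩ }
  have hle : D.m ≤ #(Below κ) := by
    rw [Below.mk_eq]
    exact lift_le.2 hμκ.le
  obtain ⟨e⟩ := Cardinal.eq.1 (hD.mk_node hle)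
  exact ⟨_, hD.isSouslinTree rfl hμκ e, hD.isCompleteTree rfl e⟩
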